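/- A flow $(X,T)$ is a nonempty compact Hausdorff space $X$ with a homeomorphism $T:X\to X$. It is minimal if every orbit $\{T^n x: n\in\mathbb Z\}$ is dense in $X$; it is distal if for all $x\neq y$ in $X$ there is a neighbourhood $V$ of the diagonal of $X\times X$ with $(T^nx,T^ny)\notin V$ for all $n\in\mathbb Z$ (for metric $X$: $\inf_{n\in\mathbb Z} d(T^nx,T^ny)>0$); it is strictly ergodic if it is minimal and has exactly one $T$-invariant (regular) Borel probability measure. For $x_0\in X$ let $al(X,x_0)\subset\ell^\infty(\mathbb Z)$ be the set of all complex-valued functions $n\mapsto F(T^nx_0)$ with $F\in C(X)$. Let $\mathcal D\subset\ell^\infty(\mathbb Z)$ be the union of the sets $al(X,x_0)$ over all minimal distal flows $(X,T)$ and all $x_0\in X$, and let the Weyl algebra $\mathcal W$ be the smallest norm closed, translation invariant subalgebra of $\ell^\infty(\mathbb Z)$ that contains the functions $n\mapsto e^{2\pi i n^k\alpha}$ for all $\alpha\in\mathbb R$ and $k\in\mathbb N$. Then $\mathcal W\subsetneq\mathcal D$. More specifically, there exists a metric minimal distal flow $(X,T)$ which is not strictly ergodic and which does not belong to $\mathcal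 W$, i.e. $al(X,x_0)\not\subset\mathcal W$ for every $x_0\in X$. -/

import Mathlib

open scoped BoundedContinuousFunction Topology

namespace WeylDistal

open MeasureTheory

/-! ### Flows

A flow is a compact Hausdorff space `X` with a homeomorphism `T : X ≃ₜ X`; `T ^ n` (`n : ℤ`) is the
`n`-th iterate of `T`, in the group of self-homeomorphisms of `X`. -/

/-- A flow is minimal if (it is nonempty and) the two-sided orbit of every point is dense. -/
structure IsMinimalFlow {X : Type*} [TopologicalSpace X] (T : X ≃ₜ X) : Prop where
  nonempty : Nonempty X
  dense_orbit : ∀ x : X, Dense (Set.range fun n : ℤ => (T ^ n) x)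

/-- A flow is distal if for all `x ≠ y` there is a neighbourhood of the diagonal that contains no
`(T ^ n x, T ^ n y)`. If `X` is a compact metric space, this says that
`inf_n d (T ^ n x, T ^ n y) > 0`; see `isDistalFlow_iff_dist`. -/
def IsDistalFlow {X : Type*} [TopologicalSpace X] (T : X ≃ₜ X) : Prop :=
  ∀ x y : X, x ≠ y → ∃ V ∈ 𝓝ˢ (Set.diagonal X), ∀ n : ℤ, ((T ^ n) x, (T ^ n) y) ∉ V

theorem isDistalFlow_iff_dist {X : Type*} [MetricSpace X] [CompactSpace X] (T : X ≃ₜ X) :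
    IsDistalFlow T ↔
      ∀ x y : X, x ≠ y → ∃ ε : ℝ, 0 < ε ∧ ∀ n : ℤ, ε ≤ dist ((T ^ n) x) ((T ^ n) y) := by
  unfold IsDistalFlow
  rw [nhdsSet_diagonal_eq_uniformity]
  refine forall_congr' fun x => forall_congr' fun y => imp_congr_right fun _ => ?_
  constructor
  · rintro ⟨V, hV, h⟩
    obtain ⟨ε, hε, hV'⟩ := Metric.mem_uniformity_dist.1 hV
    exact ⟨ε, hε, fun n => not_lt.1 fun hlt => h n (hV' hlt)⟩
  · rintro ⟨ε, hε, h⟩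
    exact ⟨{p | dist p.1 p.2 < ε}, Metric.dist_mem_uniformity hε, fun n => not_lt.2 (h n)⟩

/-- A flow is uniquely ergodic if it has exactly one invariant (regular) Borel probability measure.
Regularity is automatic if `X` is metrizable. -/
def IsUniquelyErgodic {X : Type*} [TopologicalSpace X] [MeasurableSpace X] [BorelSpace X]
    (T : X ≃ₜ X) : Prop :=
  ∃! μ : Measure X, IsProbabilityMeasure μ ∧ μ.Regular ∧ MeasurePreserving T μ μ

/-- A flow is strictly ergodic if it is uniquely ergodic and minimal. -/
def IsStrictlyErgodic {X : Type*} [TopologicalSpace X] [MeasurableSpace X] [BorelSpace X]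
    (T : X ≃ₜ X) : Prop :=
  IsUniquelyErgodic T ∧ IsMinimalFlow T

/-! ### Functions on `ℤ`

`ℤ →ᵇ ℂ` is `ℓ^∞(ℤ)`: all bounded functions on the discrete space `ℤ`, with the sup norm and the
pointwise operations. -/

/-- `al(X, x₀)`: the functions `n ↦ F (T ^ n x₀)` with `F` a continuous function on `X`. -/
def flowAlgebra {X : Type*} [TopologicalSpace X] (T : X ≃ₜ X) (x₀ : X) : Set (ℤ →ᵇ ℂ) :=
  {f | ∃ F : C(X, ℂ), ∀ n : ℤ, f n = F ((T ^ n) x₀)}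

/-- The family `𝒟` of distal functions: those that come from some minimal distal flow.
A minimal compact Hausdorff flow has a countable dense subset, hence at most `2 ^ (2 ^ ℵ₀)` points,
so that flows in `Type` give all of them. -/
def distalFunctions : Set (ℤ →ᵇ ℂ) :=
  {f | ∃ (X : Type) (_ : TopologicalSpace X) (_ : CompactSpace X) (_ : T2Space X)
      (T : X ≃ₜ X) (x₀ : X), IsMinimalFlow T ∧ IsDistalFlow T ∧ f ∈ flowAlgebra T x₀}

/-- The function `f_{α,k} : n ↦ exp (2 π i n ^ k α)`. -/
noncomputable def weylFunction (α : ℝ) (k : ℕ) : ℤ →ᵇ ℂ :=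
  BoundedContinuousFunction.ofNormedAddCommGroupDiscrete
    (fun n : ℤ => Complex.exp (2 * Real.pi * Complex.I * (n : ℂ) ^ k * α)) 1 fun n => by
      have h : (2 * Real.pi * Complex.I * (n : ℂ) ^ k * α : ℂ)
          = ((2 * Real.pi * (n : ℝ) ^ k * α : ℝ) : ℂ) * Complex.I := by
        push_cast
        ring
      rw [h, Complex.norm_exp_ofReal_mul_I]

/-- The translate `n ↦ f (n + m)`. -/
noncomputable def shift (m : ℤ) (f : ℤ →ᵇ ℂ) : ℤ →ᵇ ℂ :=
  f.compContinuous ⟨fun n => n + m, continuous_of_discreteTopology⟩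

/-- The Weyl algebra `𝒲`: the smallest norm closed, translation invariant subalgebra of `ℓ^∞(ℤ)`
that contains all functions `f_{α,k}`. -/
noncomputable def weylAlgebra : Subalgebra ℂ (ℤ →ᵇ ℂ) :=
  sInf {A | IsClosed (A : Set (ℤ →ᵇ ℂ)) ∧ (∀ m : ℤ, ∀ f ∈ A, shift m f ∈ A) ∧
    ∀ (α : ℝ) (k : ℕ), weylFunction α k ∈ A}

end WeylDistal

/-! For the inclusion, a single distal flow produces all generators of `weylAlgebra` at once. On
families of circle-valued sequences, the maps (mᵏ a)ₖ ↦ ((m + n)ᵏ a)ₖ are unipotent, hence distal.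
By Ellis (`IsDistalFlow.mem_closure_orbit`) orbit closures in a distal flow are minimal, and the
functions read off at a point of a minimal flow form a closed, translation invariant algebra.

The obstruction that makes it strict is that all shift-invariant means agree on the Weyl algebra
(`IsInvariantMean.eq_on_weylAlgebra`). That algebra lies in the closed span of the phases e(p(n)), p
a real polynomial, and each phase is either periodic or, by van der Corput differencing, of mean
zero.

The distal flow is (x, t) ↦ (x + 1, t + Σᵢ (ρᵢ(x + 1) - ρᵢ(x))) over the 2-adic odometer. Within a
period Lᵢ₊₁ = 2^(i+3) wᵢ the ramp ρᵢ winds once around the circle in wᵢ steps and then stays at 0.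
Its increments have size at most 1/wᵢ, so the series converges uniformly. Moving by multiples of Lₘ,
up to length Lₘ₊₁, fixes the ρᵢ with i < m, barely moves those with i > m, and brings ρₘ within
2^(-m) of any value; this gives minimality. Yet the ρᵢ are nonzero on sets of total density at most
1/4, so the fiber character has averages above 1/4 over arbitrarily long windows. The half turn of
the fibers commutes with the flow and reverses the sign. Limits of these averages are distinct
invariant means, and distinct invariant measures. -/

namespace WeylDistal

/-! ### Distal flows: orbit closures and the algebra of a point -/

section Flow

variable {X : Type*} [TopologicalSpace X]

/-- In a compact distal flow, a point belongs to the orbit closure of every point of its own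
orbit closure (Ellis). -/
theorem IsDistalFlow.mem_closure_orbit [CompactSpace X] [T2Space X] {T : X ≃ₜ X}
    (hT : IsDistalFlow T) {x z : X} (hz : z ∈ closure (Set.range fun n : ℤ => (T ^ n) x)) :
    x ∈ closure (Set.range fun n : ℤ => (T ^ n) z) := by
  let instTop : TopologicalSpace (Function.End X) := Pi.topologicalSpace
  have instT2 : T2Space (Function.End X) := inferInstanceAs (T2Space (X → X))
  have instC : CompactSpace (Function.End X) := inferInstanceAs (CompactSpace (X → X))
  have eval_cont (y : X) : Continuous fun p : Function.End X => p y := continuous_apply y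
  have mul_cont (r : Function.End X) : Continuous (· * r) :=
    continuous_pi fun y => continuous_apply (r y)
  let τ (n : ℤ) : Function.End X := fun y => (T ^ n) y
  let O : Set (Function.End X) := Set.range τ
  let E : Set (Function.End X) := closure O
  have hO (n : ℤ) : τ n ∈ O := ⟨n, rfl⟩
  have hleft (n : ℤ) (q : Function.End X) (hq : q ∈ E) :
      τ n * q ∈ E := by
    have hc : Continuous fun q : Function.End X => τ n * q :=
      continuous_pi fun y => (T ^ n).continuous.comp (continuous_apply y)
    refine map_mem_closure hc hq ?_
    rintro _ ⟨m, rfl⟩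
    refine ⟨n + m, ?_⟩
    funext y
    change (T ^ (n + m)) y = (T ^ n) ((T ^ m) y)
    rw [zpow_add, Homeomorph.mul_apply]
  have hE : ∀ p ∈ E, ∀ q ∈ E, p * q ∈ E := by
    intro p hp q hq
    have := map_mem_closure (mul_cont q) hp (t := E) (by
      rintro _ ⟨n, rfl⟩
      exact hleft n q hq)
    rwa [isClosed_closure.closure_eq] at this
  have himage (y : X) : (fun p : Function.End X => p y) '' E =
      closure (Set.range fun n : ℤ => (T ^ n) y) := by
    have h1 := image_closure_of_isCompact (s := O) (isClosed_closure.isCompact)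
      (eval_cont y).continuousOn
    refine h1.trans ?_
    rw [← Set.range_comp]
    rfl
  rw [← himage] at hz ⊢
  obtain ⟨q, hq, rfl⟩ := hz
  -- The left ideal `E * q` of the enveloping semigroup is compact, so it contains an idempotent u =
  -- r * q. Distality will force u x = x, that is, r (q x) = x.
  obtain ⟨u, ⟨r, hr, rfl⟩, hu⟩ := exists_idempotent_in_compact_subsemigroup mul_cont
    ((· * q) '' E) ((closure_nonempty_iff.2 ⟨_, hO 0⟩).image _)
    (isClosed_closure.isCompact.image (mul_cont q)) (by
      rintro _ ⟨a, ha, rfl⟩ _ ⟨b, hb, rfl⟩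
      exact ⟨a * q * b, hE _ (hE _ ha _ hq) _ hb, rfl⟩)
  have hrq : r * q ∈ E := hE _ hr _ hq
  refine ⟨r, hr, ?_⟩
  by_contra hne
  obtain ⟨V, hV, hdist⟩ := hT _ _ hne
  have hpair : Continuous fun p : Function.End X => (p ((r * q) x), p x) :=
    (eval_cont _).prodMk (eval_cont _)
  -- The idempotent sends both u x and x to u x, so powers of `T` close to it carry this pair into
  -- any neighbourhood of the diagonal.
  have hmem : (fun p : Function.End X => (p ((r * q) x), p x)) (r * q) ∈ interior V := by
    have h2 : (r * q) ((r * q) x) = (r * q) x := congrFun hu x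
    simp only [h2]
    exact (subset_interior_iff_mem_nhdsSet.2 hV) rfl
  obtain ⟨_, hp, n, rfl⟩ := mem_closure_iff.1 hrq _ (isOpen_interior.preimage hpair) hmem
  exact hdist n (interior_subset hp)

theorem zpow_mem_closure_orbit {T : X ≃ₜ X} {x y : X}
    (hy : y ∈ closure (Set.range fun n : ℤ => (T ^ n) x)) (m : ℤ) :
    (T ^ m) y ∈ closure (Set.range fun n : ℤ => (T ^ n) x) := by
  refine map_mem_closure (T ^ m).continuous hy ?_
  rintro _ ⟨n, rfl⟩
  exact ⟨m + n, by simp only [zpow_add]; rfl⟩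

/-- The restriction of a flow to an orbit closure. -/
def orbitFlow (T : X ≃ₜ X) (x : X) :
    closure (Set.range fun n : ℤ => (T ^ n) x) ≃ₜ closure (Set.range fun n : ℤ => (T ^ n) x) :=
  T.subtype fun y => ⟨fun h => by simpa using zpow_mem_closure_orbit h 1, fun h => by
    have := zpow_mem_closure_orbit h (-1)
    rw [zpow_neg_one] at this
    convert this using 1
    exact (T.symm_apply_apply y).symm⟩

theorem coe_orbitFlow_zpow (T : X ≃ₜ X) (x : X) (n : ℤ)
    (y : closure (Set.range fun n : ℤ => (T ^ n) x)) :
    ((orbitFlow T x ^ n) y : X) = (T ^ n) y := by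
  have hpos : ∀ (n : ℕ) (y : closure (Set.range fun n : ℤ => (T ^ n) x)),
      ((orbitFlow T x ^ n) y : X) = (T ^ n) y := by
    intro n
    induction n with
    | zero => intro y; rfl
    | succ n ih =>
      intro y
      rw [pow_succ, pow_succ]
      exact ih _
  obtain ⟨n, rfl | rfl⟩ := n.eq_nat_or_neg
  · simpa using hpos n y
  · have h := hpos n ((orbitFlow T x ^ (-(n : ℤ))) y)
    rw [show (orbitFlow T x ^ n) ((orbitFlow T x ^ (-(n : ℤ))) y) = y by
      rw [← zpow_natCast, ← Homeomorph.mul_apply, ← zpow_add]; simp] at h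
    rw [h, ← zpow_natCast, ← Homeomorph.mul_apply, ← zpow_add]
    simp

/-- For z in the orbit closure of x, Ellis' theorem puts x, and with it the whole orbit closure of
x, into the orbit closure of z. -/
theorem IsDistalFlow.isMinimalFlow_orbitFlow [CompactSpace X] [T2Space X] {T : X ≃ₜ X}
    (hT : IsDistalFlow T) (x : X) : IsMinimalFlow (orbitFlow T x) where
  nonempty := ⟨⟨x, subset_closure ⟨0, rfl⟩⟩⟩
  dense_orbit z := by
    intro y
    rw [Topology.IsInducing.subtypeVal.closure_eq_preimage_closure_image, ← Set.range_comp]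
    have h1 : ((Subtype.val : _ → X) ∘ fun n : ℤ => (orbitFlow T x ^ n) z) =
        fun n : ℤ => (T ^ n) z.1 :=
      funext fun n => coe_orbitFlow_zpow T x n z
    rw [h1]
    have h2 : closure (Set.range fun n : ℤ => (T ^ n) x) ⊆
        closure (Set.range fun n : ℤ => (T ^ n) (z : X)) := by
      refine closure_minimal ?_ isClosed_closure
      rintro _ ⟨n, rfl⟩
      exact zpow_mem_closure_orbit (hT.mem_closure_orbit z.2) n
    exact h2 y.2

theorem IsDistalFlow.isDistalFlow_orbitFlow {T : X ≃ₜ X} (hT : IsDistalFlow T) (x : X) :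
    IsDistalFlow (orbitFlow T x) := by
  intro y z hyz
  obtain ⟨V, hV, h⟩ := hT y z (Subtype.coe_ne_coe.2 hyz)
  have hc : Continuous (Prod.map Subtype.val Subtype.val :
      closure (Set.range fun n : ℤ => (T ^ n) x) × closure (Set.range fun n : ℤ => (T ^ n) x) →
        X × X) := by fun_prop
  refine ⟨_, (hc.tendsto_nhdsSet (s := Set.diagonal _) (t := Set.diagonal X) ?_) hV, ?_⟩
  · rintro ⟨a, b⟩ hab
    exact congrArg Subtype.val hab
  · intro n hn
    apply h n
    simpa [coe_orbitFlow_zpow] using hn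

/-- The functions on `ℤ` coming from a point of a flow form an algebra. -/
def flowSubalgebra (T : X ≃ₜ X) (x₀ : X) : Subalgebra ℂ (ℤ →ᵇ ℂ) where
  carrier := flowAlgebra T x₀
  mul_mem' := by
    rintro f g ⟨F, hF⟩ ⟨G, hG⟩
    exact ⟨F * G, fun n => by simp [hF, hG]⟩
  add_mem' := by
    rintro f g ⟨F, hF⟩ ⟨G, hG⟩
    exact ⟨F + G, fun n => by simp [hF, hG]⟩
  algebraMap_mem' c := ⟨algebraMap ℂ _ c, fun n => by simp⟩

theorem shift_mem_flowAlgebra {T : X ≃ₜ X} {x₀ : X} {f : ℤ →ᵇ ℂ} (hf : f ∈ flowAlgebra T x₀)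
    (m : ℤ) : shift m f ∈ flowAlgebra T x₀ := by
  obtain ⟨F, hF⟩ := hf
  refine ⟨F.comp ⟨fun y => (T ^ m) y, (T ^ m).continuous⟩, fun n => ?_⟩
  change f (n + m) = F ((T ^ m) ((T ^ n) x₀))
  rw [hF, ← Homeomorph.mul_apply, ← zpow_add, add_comm]

/-- Density of the orbit makes F ↦ (F(Tⁿ x₀))ₙ an isometry on the complete space C(X), so its range
is closed. -/
theorem isClosed_flowAlgebra [CompactSpace X] {T : X ≃ₜ X} {x₀ : X}
    (h : Dense (Set.range fun n : ℤ => (T ^ n) x₀)) : IsClosed (flowAlgebra T x₀) := by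
  let ρ : C(X, ℂ) → (ℤ →ᵇ ℂ) := fun F =>
    BoundedContinuousFunction.ofNormedAddCommGroupDiscrete (fun n => F ((T ^ n) x₀)) ‖F‖
      fun n => F.norm_coe_le_norm _
  have hρ : Isometry ρ := by
    refine Isometry.of_dist_eq fun F G => le_antisymm ?_ ?_
    · rw [BoundedContinuousFunction.dist_le dist_nonneg]
      exact fun n => ContinuousMap.dist_apply_le_dist (f := F) (g := G) _
    · rw [ContinuousMap.dist_le dist_nonneg]
      have hcl : IsClosed {x | dist (F x) (G x) ≤ dist (ρ F) (ρ G)} :=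
        isClosed_le (by fun_prop) continuous_const
      intro x
      refine (hcl.closure_subset_iff.2 ?_) (h x)
      rintro _ ⟨n, rfl⟩
      exact BoundedContinuousFunction.dist_coe_le_dist (f := ρ F) (g := ρ G) n
  have himg : flowAlgebra T x₀ = Set.range ρ := by
    ext f
    constructor
    · rintro ⟨F, hF⟩
      exact ⟨F, BoundedContinuousFunction.ext fun n => (hF n).symm⟩
    · rintro ⟨F, rfl⟩
      exact ⟨F, fun n => rfl⟩
  rw [himg]
  exact hρ.isClosedEmbedding.isClosed_range

end Flow

/-! ### The polynomial flow -/

/-- The action of `n : ℤ` on sequences of polynomial type: it maps `(mᵏ a)ₖ` to `((m + n)ᵏ a)ₖ`. -/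
def binomialShift (n : ℤ) (y : ℝ → ℕ → UnitAddCircle) : ℝ → ℕ → UnitAddCircle :=
  fun a k => ∑ j ∈ Finset.range (k + 1), ((k.choose j : ℤ) * n ^ (k - j)) • y a j

theorem continuous_binomialShift (n : ℤ) : Continuous (binomialShift n) := by
  unfold binomialShift
  fun_prop

theorem binomialShift_zero (y : ℝ → ℕ → UnitAddCircle) : binomialShift 0 y = y := by
  funext a k
  rw [binomialShift, Finset.sum_range_succ, Finset.sum_eq_zero]
  · simp
  · intro j hj
    rw [zero_pow (by have := Finset.mem_range.1 hj; omega)]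
    simp

theorem binomialShift_add (m n : ℤ) (y : ℝ → ℕ → UnitAddCircle) :
    binomialShift m (binomialShift n y) = binomialShift (m + n) y := by
  funext a k
  simp only [binomialShift, Finset.smul_sum, smul_smul]
  rw [Finset.sum_comm' (t' := Finset.range (k + 1)) (s' := fun l => Finset.Ico l (k + 1))
    fun j l => by simp only [Finset.mem_range, Finset.mem_Ico]; omega]
  refine Finset.sum_congr rfl fun l hl => ?_
  have hl : l ≤ k := by simpa [Nat.lt_succ_iff] using hl
  rw [← Finset.sum_smul, Finset.sum_Ico_eq_sum_range, add_comm m n, add_pow, Finset.mul_sum,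
    Nat.sub_add_comm hl]
  congr 1
  refine Finset.sum_congr rfl fun i hi => ?_
  have hi : i ≤ k - l := by simpa [Nat.lt_succ_iff] using hi
  -- After the sums are exchanged, C(k, j) C(j, l) = C(k, l) C(k - l, j - l) reduces the claim to
  -- the binomial theorem for (n + m)^(k - l).
  have hc := Nat.choose_mul (n := k) (k := l + i) (s := l) (by omega)
  rw [Nat.add_sub_cancel_left] at hc ⊢
  rw [show k - (l + i) = k - l - i by omega]
  have hc' : (k.choose (l + i) : ℤ) * ((l + i).choose l : ℤ) =
      (k.choose l : ℤ) * ((k - l).choose i : ℤ) := by exact_mod_cast hc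
  linear_combination m ^ (k - l - i) * n ^ i * hc'

/-- The flow generated by `binomialShift 1`. -/
def polynomialFlow : (ℝ → ℕ → UnitAddCircle) ≃ₜ (ℝ → ℕ → UnitAddCircle) where
  toFun := binomialShift 1
  invFun := binomialShift (-1)
  left_inv y := by rw [binomialShift_add]; exact binomialShift_zero y
  right_inv y := by rw [binomialShift_add]; exact binomialShift_zero y
  continuous_toFun := continuous_binomialShift 1
  continuous_invFun := continuous_binomialShift (-1)

theorem polynomialFlow_zpow (n : ℤ) (y : ℝ → ℕ → UnitAddCircle) :
    (polynomialFlow ^ n) y = binomialShift n y := by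
  induction n with
  | zero => exact (binomialShift_zero y).symm
  | succ n ih =>
    rw [add_comm, zpow_add, Homeomorph.mul_apply, ih, zpow_one, ← binomialShift_add]
    rfl
  | pred n ih =>
    rw [sub_eq_neg_add, zpow_add, Homeomorph.mul_apply, ih, zpow_neg_one, ← binomialShift_add]
    rfl

/-- The action is lower triangular with ones on the diagonal, so the difference at the first
coordinate where two points disagree is constant along the orbit. -/
theorem isDistalFlow_polynomialFlow : IsDistalFlow polynomialFlow := by
  classical
  intro x y hxy
  obtain ⟨a, ha⟩ := Function.ne_iff.1 hxy
  have hex : ∃ k, x a k ≠ y a k := Function.ne_iff.1 ha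
  set k := Nat.find hex with hk
  have hne : x a k ≠ y a k := Nat.find_spec hex
  have hlt : ∀ j < k, x a j = y a j := fun j hj => not_not.1 (Nat.find_min hex hj)
  refine ⟨{p | p.1 a k - p.2 a k ≠ x a k - y a k}, ?_, ?_⟩
  · refine IsOpen.mem_nhdsSet ?_ |>.2 ?_
    · exact isOpen_ne_fun (by fun_prop) continuous_const
    · rintro ⟨p, q⟩ hpq
      obtain rfl : p = q := hpq
      change p a k - p a k ≠ _
      rw [sub_self]
      exact (sub_ne_zero.2 hne).symm
  · intro n hn
    apply hn
    simp only [polynomialFlow_zpow, binomialShift]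
    rw [← Finset.sum_sub_distrib, Finset.sum_range_succ, Finset.sum_eq_zero]
    · simp
    · intro j hj
      rw [hlt j (Finset.mem_range.1 hj), sub_self]

theorem weylAlgebra_subset_distalFunctions :
    (weylAlgebra : Set (ℤ →ᵇ ℂ)) ⊆ distalFunctions := by
  -- This is the family (0ᵏ a)ₖ, with 0⁰ = 1; its n-th iterate is (nᵏ a)ₖ, for all real a
  -- simultaneously.
  let p : ℝ → ℕ → UnitAddCircle := fun a k => if k = 0 then (a : UnitAddCircle) else 0
  let C := closure (Set.range fun n : ℤ => (polynomialFlow ^ n) p)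
  let p₀ : C := ⟨p, subset_closure ⟨0, rfl⟩⟩
  have hmin := isDistalFlow_polynomialFlow.isMinimalFlow_orbitFlow p
  have : CompactSpace C := isCompact_iff_compactSpace.1 isClosed_closure.isCompact
  have hle : weylAlgebra ≤ flowSubalgebra (orbitFlow polynomialFlow p) p₀ := by
    refine sInf_le ⟨isClosed_flowAlgebra (hmin.dense_orbit p₀),
      fun m f hf => shift_mem_flowAlgebra hf m, fun α k => ?_⟩
    refine ⟨⟨fun z => (AddCircle.toCircle (z.1 α k) : ℂ), ?_⟩, fun n => ?_⟩
    · exact continuous_subtype_val.comp (AddCircle.continuous_toCircle.comp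
        ((continuous_apply_apply α k).comp continuous_subtype_val))
    · change Complex.exp _ = (AddCircle.toCircle (((orbitFlow polynomialFlow p ^ n) p₀ : C).1 α k) : ℂ)
      rw [coe_orbitFlow_zpow, polynomialFlow_zpow]
      have h1 : binomialShift n p₀.1 α k = (((n : ℝ) ^ k * α : ℝ) : UnitAddCircle) := by
        rw [binomialShift, Finset.sum_eq_single 0]
        · simp only [p₀, p, if_true, Nat.choose_zero_right, Nat.cast_one, one_mul, Nat.sub_zero]
          rw [← AddCircle.coe_zsmul, zsmul_eq_mul]
          push_cast
          rfl
        · intro j _ hj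
          simp [p₀, p, hj]
        · simp
      rw [h1, AddCircle.toCircle_apply_mk, Circle.coe_exp]
      congr 1
      push_cast
      ring
  intro f hf
  exact ⟨C, inferInstance, inferInstance, inferInstance, orbitFlow polynomialFlow p, p₀, hmin,
    isDistalFlow_polynomialFlow.isDistalFlow_orbitFlow p, hle hf⟩

end WeylDistal

namespace WeylDistal

/-! ### Invariant means on `ℤ` -/

section Mean

open Filter Polynomial

/-- A shift-invariant mean on `ℓ^∞(ℤ)`; positivity enters through the Cauchy-Schwarz inequality. -/
structure IsInvariantMean (μ : (ℤ →ᵇ ℂ) →ₗ[ℂ] ℂ) : Prop where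
  map_one : μ 1 = 1
  map_shift : ∀ (k : ℤ) (f : ℤ →ᵇ ℂ), μ (shift k f) = μ f
  norm_le : ∀ f : ℤ →ᵇ ℂ, ‖μ f‖ ≤ ‖f‖
  norm_sq_le : ∀ f : ℤ →ᵇ ℂ, ‖μ f‖ ^ 2 ≤ (μ (star f * f)).re

variable {μ ν : (ℤ →ᵇ ℂ) →ₗ[ℂ] ℂ}

theorem shift_apply (m : ℤ) (f : ℤ →ᵇ ℂ) (n : ℤ) : shift m f n = f (n + m) := rfl

/-- Van der Corput's lemma for invariant means. -/
theorem IsInvariantMean.eq_zero_of_correlations (hμ : IsInvariantMean μ) (u : ℤ →ᵇ ℂ)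
    (hu : ∀ h : ℤ, h ≠ 0 → μ (star u * WeylDistal.shift h u) = 0) : μ u = 0 := by
  -- Cauchy-Schwarz is applied to the sum of H translates of u. Only the H diagonal correlations
  -- survive, and letting H grow forces μ u = 0.
  have key : ∀ H : ℕ, (H : ℝ) ^ 2 * ‖μ u‖ ^ 2 ≤ H * ‖star u * u‖ := by
    intro H
    let w : ℤ →ᵇ ℂ := ∑ h ∈ Finset.range H, WeylDistal.shift (h : ℤ) u
    have hw : μ w = H * μ u := by
      simp [w, map_sum, hμ.map_shift]
    have hww : μ (star w * w) = H * μ (star u * u) := by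
      have h1 : star w * w = ∑ h ∈ Finset.range H, ∑ h' ∈ Finset.range H,
          WeylDistal.shift (h : ℤ) (star u * WeylDistal.shift ((h' : ℤ) - h) u) := by
        simp only [w, star_sum, Finset.sum_mul_sum]
        refine Finset.sum_congr rfl fun h _ => Finset.sum_congr rfl fun h' _ => ?_
        ext n
        simp only [BoundedContinuousFunction.mul_apply, BoundedContinuousFunction.star_apply,
          shift_apply]
        rw [show n + (h : ℤ) + (h' - h) = n + h' by ring]
      rw [h1, map_sum]
      simp only [map_sum, hμ.map_shift]
      rw [Finset.sum_congr rfl fun h hh => Finset.sum_eq_single_of_mem h hh fun h' _ hne => hu _ ?_]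
      · have h0 : WeylDistal.shift 0 u = u := by ext n; simp [shift_apply]
        simp [h0]
      · exact sub_ne_zero.2 (by exact_mod_cast hne)
    have h2 := hμ.norm_sq_le w
    rw [hw, hww, norm_mul, mul_pow, Complex.norm_natCast] at h2
    refine h2.trans ?_
    rw [← Complex.ofReal_natCast, Complex.re_ofReal_mul]
    gcongr
    exact (Complex.re_le_norm _).trans (hμ.norm_le _)
  by_contra hne
  have hpos : 0 < ‖μ u‖ ^ 2 := by positivity
  obtain ⟨H, hH⟩ := exists_nat_gt (‖star u * u‖ / ‖μ u‖ ^ 2)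
  rw [div_lt_iff₀ hpos] at hH
  have hH0 : (0 : ℝ) < H := by
    rcases H.eq_zero_or_pos with rfl | h
    · simp only [Nat.cast_zero, zero_mul] at hH
      exact absurd hH (not_lt.2 (norm_nonneg _))
    · exact_mod_cast h
  have := key H
  nlinarith

/-! ### Polynomial phases and their means -/

/-- The function `n ↦ exp (2 π i p(n))`. -/
noncomputable def phase (p : ℝ[X]) : ℤ →ᵇ ℂ :=
  BoundedContinuousFunction.ofNormedAddCommGroupDiscrete
    (fun n : ℤ => (AddCircle.toCircle ((p.eval (n : ℝ) : ℝ) : UnitAddCircle) : ℂ)) 1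
    fun _ => (Circle.norm_coe _).le

theorem phase_apply (p : ℝ[X]) (n : ℤ) :
    phase p n = (AddCircle.toCircle ((p.eval (n : ℝ) : ℝ) : UnitAddCircle) : ℂ) := rfl

theorem phase_add (p q : ℝ[X]) : phase (p + q) = phase p * phase q := by
  ext n
  simp [phase_apply, AddCircle.toCircle_add]

theorem phase_zero : phase 0 = 1 := by
  ext n
  simp [phase_apply]

theorem star_phase (p : ℝ[X]) : star (phase p) = phase (-p) := by
  ext n
  simp [phase_apply, AddCircle.toCircle_neg, ← Circle.coe_inv_eq_conj]

theorem shift_phase (h : ℤ) (p : ℝ[X]) : shift h (phase p) = phase (taylor (h : ℝ) p) := by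
  ext n
  simp [phase_apply, shift_apply, taylor_eval]

theorem star_phase_mul_shift (h : ℤ) (p : ℝ[X]) :
    star (phase p) * shift h (phase p) = phase (taylor (h : ℝ) p - p) := by
  rw [star_phase, shift_phase, ← phase_add, neg_add_eq_sub]

theorem coe_unitAddCircle_intCast (n : ℤ) : ((n : ℝ) : UnitAddCircle) = 0 :=
  (AddCircle.coe_eq_zero_iff _).2 ⟨n, by simp⟩

theorem phase_eq_one_of_int {p : ℝ[X]} (h : ∀ n : ℤ, ∃ k : ℤ, p.eval (n : ℝ) = k) :
    phase p = 1 := by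
  ext n
  obtain ⟨k, hk⟩ := h n
  rw [phase_apply, hk, coe_unitAddCircle_intCast]
  simp

/-- A rational polynomial is periodic modulo `1`. -/
theorem exists_period (r : ℚ[X]) : ∃ b : ℕ, 0 < b ∧
    phase (taylor (b : ℝ) (r.map (algebraMap ℚ ℝ)) - r.map (algebraMap ℚ ℝ)) = 1 := by
  -- A common denominator b of the coefficients is already a period: b divides s(n + b) - s(n) for
  -- the integer polynomial s = b r.
  obtain ⟨b, hb, s, hs⟩ : ∃ b : ℕ, 0 < b ∧ ∃ s : ℤ[X], (b : ℚ) • r = s.map (Int.castRingHom ℚ) := by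
    induction r using Polynomial.induction_on' with
    | add p q hp hq =>
      obtain ⟨b, hb, s, hs⟩ := hp
      obtain ⟨c, hc, t, ht⟩ := hq
      refine ⟨b * c, Nat.mul_pos hb hc, (c : ℤ) • s + (b : ℤ) • t, ?_⟩
      simp only [Polynomial.map_add, Polynomial.map_smul, ← hs, ← ht, smul_smul, smul_add]
      simp [mul_comm]
    | monomial n a =>
      refine ⟨a.den, a.den_pos, monomial n a.num, ?_⟩
      rw [smul_monomial, map_monomial]
      simp [Rat.den_mul_eq_num]
  refine ⟨b, hb, phase_eq_one_of_int fun n => ?_⟩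
  obtain ⟨k, hk⟩ : (b : ℤ) ∣ s.eval (n + b) - s.eval n := by
    simpa using s.sub_dvd_eval_sub (n + b) n
  refine ⟨k, ?_⟩
  have hev : ∀ m : ℤ, (b : ℝ) * (r.map (algebraMap ℚ ℝ)).eval (m : ℝ) = (s.eval m : ℤ) := by
    intro m
    have h1 : (b : ℚ) * r.eval (m : ℚ) = (s.eval m : ℤ) := by
      rw [← smul_eq_mul, ← eval_smul, hs, eval_intCast_map]
      simp
    have h2 : (r.map (algebraMap ℚ ℝ)).eval (m : ℝ) = ((r.eval (m : ℚ) : ℚ) : ℝ) := by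
      rw [eval_intCast_map]
      simp
    rw [h2]
    exact_mod_cast h1
  have h1 := hev (n + b)
  have h2 := hev n
  rw [eval_sub, taylor_eval]
  have hb' : (b : ℝ) ≠ 0 := by positivity
  have hk' : ((s.eval (n + b) : ℤ) : ℝ) - (s.eval n : ℤ) = b * k := by exact_mod_cast hk
  push_cast at h1
  apply mul_left_cancel₀ hb'
  linarith

/-- Differencing lowers the degree bound by one and multiplies the top coefficient by (i + 1) h,
which preserves irrationality for integers h ≠ 0. -/
theorem coeff_taylor_sub (q : ℝ[X]) (i : ℕ) (hq : q.natDegree ≤ i + 1) (h : ℝ) :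
    (taylor h q - q).natDegree ≤ i ∧ (taylor h q - q).coeff i = (i + 1) * h * q.coeff (i + 1) := by
  constructor
  · rw [natDegree_le_iff_coeff_eq_zero]
    intro N hN
    rw [coeff_sub]
    rcases (Nat.succ_le_of_lt hN).eq_or_lt with rfl | hlt
    · rcases hq.eq_or_lt with heq | hlt
      · rw [Nat.succ_eq_add_one, ← heq, coeff_taylor_natDegree, leadingCoeff, sub_self]
      · rw [coeff_eq_zero_of_natDegree_lt (by rwa [natDegree_taylor]),
          coeff_eq_zero_of_natDegree_lt hlt, sub_self]
    · rw [coeff_eq_zero_of_natDegree_lt (by rw [natDegree_taylor]; omega),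
        coeff_eq_zero_of_natDegree_lt (by omega), sub_self]
  · have hd : (hasseDeriv i q).natDegree < 2 := by
      have := natDegree_hasseDeriv_le q i
      omega
    rw [coeff_sub, taylor_coeff, eval_eq_sum_range' hd, Finset.sum_range_succ,
      Finset.sum_range_one, hasseDeriv_coeff, hasseDeriv_coeff, zero_add, Nat.choose_self,
      add_comm 1 i, Nat.choose_succ_self_right]
    push_cast
    ring

/-- Weyl's induction on the degree of q; the rational part r, of any degree, stays separate because
differencing keeps it rational. In the linear case, translation by a period b of r multiplies the
phase by e(bα) ≠ 1. In the inductive step the correlations are phases of lower degree, so van der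
Corput applies. -/
theorem IsInvariantMean.phase_eq_zero (hμ : IsInvariantMean μ) (i : ℕ) :
    ∀ (q : ℝ[X]) (r : ℚ[X]), q.natDegree ≤ i + 1 → Irrational (q.coeff (i + 1)) →
      μ (phase (q + r.map (algebraMap ℚ ℝ))) = 0 := by
  induction i with
  | zero =>
    intro q r hq hirr
    obtain ⟨b, hb, hr⟩ := exists_period r
    obtain ⟨hd, hc⟩ := coeff_taylor_sub q 0 hq b
    have hconst : taylor (b : ℝ) q - q = C ((b : ℝ) * q.coeff 1) := by
      rw [eq_C_of_natDegree_le_zero hd, hc]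
      simp
    set u := phase (q + r.map (algebraMap ℚ ℝ)) with hu
    set c : ℂ := (AddCircle.toCircle (((b : ℝ) * q.coeff 1 : ℝ) : UnitAddCircle) : ℂ) with hcdef
    have h1 : WeylDistal.shift b u = c • u := by
      have h2 : taylor (b : ℝ) (q + r.map (algebraMap ℚ ℝ)) =
          (taylor (b : ℝ) q - q) + (taylor (b : ℝ) (r.map (algebraMap ℚ ℝ)) -
            r.map (algebraMap ℚ ℝ)) + (q + r.map (algebraMap ℚ ℝ)) := by
        rw [map_add]; ring
      rw [hu, shift_phase, Int.cast_natCast, h2, phase_add, phase_add, hr, mul_one, hconst]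
      ext n
      simp [phase_apply, hcdef]
    have hc1 : c ≠ 1 := by
      intro h
      rw [hcdef, Circle.coe_eq_one, ← AddCircle.toCircle_zero (T := 1)] at h
      obtain ⟨k, hk⟩ := (AddCircle.coe_eq_zero_iff _).1 (AddCircle.injective_toCircle one_ne_zero h)
      have := (hirr.natCast_mul hb.ne')
      apply this.ne_int k
      simpa using hk.symm
    have h3 := hμ.map_shift b u
    rw [h1, map_smul, smul_eq_mul] at h3
    have h4 : (c - 1) * μ u = 0 := by linear_combination h3
    exact (mul_eq_zero.1 h4).resolve_left (sub_ne_zero.2 hc1)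
  | succ i ih =>
    intro q r hq hirr
    refine hμ.eq_zero_of_correlations _ fun h hh => ?_
    obtain ⟨hd, hc⟩ := coeff_taylor_sub q (i + 1) hq h
    rw [star_phase_mul_shift, map_add, add_sub_add_comm]
    have h1 : taylor (h : ℝ) (r.map (algebraMap ℚ ℝ)) - r.map (algebraMap ℚ ℝ) =
        (taylor (h : ℚ) r - r).map (algebraMap ℚ ℝ) := by
      simp [Polynomial.map_sub, map_taylor]
    rw [h1]
    refine ih _ _ hd ?_
    rw [hc]
    have h2 := hirr.intCast_mul (m := (i + 2 : ℕ) * h)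
      (mul_ne_zero (by positivity) hh)
    convert h2 using 1
    push_cast
    ring

/-- Rational leading terms are moved into r until an irrational coefficient of positive degree
appears or only a constant, possibly irrational, is left. -/
theorem exists_rational_decomposition (p : ℝ[X]) : ∃ r : ℚ[X],
    (∃ c : ℝ, p = C c + r.map (algebraMap ℚ ℝ)) ∨
    ∃ (i : ℕ) (q : ℝ[X]), q.natDegree ≤ i + 1 ∧ Irrational (q.coeff (i + 1)) ∧
      p = q + r.map (algebraMap ℚ ℝ) := by
  suffices h : ∀ (n : ℕ) (p : ℝ[X]), p.natDegree ≤ n → ∃ r : ℚ[X],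
      (∃ c : ℝ, p = C c + r.map (algebraMap ℚ ℝ)) ∨
      ∃ (i : ℕ) (q : ℝ[X]), q.natDegree ≤ i + 1 ∧ Irrational (q.coeff (i + 1)) ∧
        p = q + r.map (algebraMap ℚ ℝ) from h _ p le_rfl
  intro n
  induction n with
  | zero =>
    intro p hp
    exact ⟨0, Or.inl ⟨p.coeff 0, by simpa using eq_C_of_natDegree_le_zero hp⟩⟩
  | succ n ih =>
    intro p hp
    by_cases hirr : Irrational (p.coeff (n + 1))
    · exact ⟨0, Or.inr ⟨n, p, hp, hirr, by simp⟩⟩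
    · obtain ⟨a, ha⟩ := not_not.1 hirr
      have hdeg : (p - monomial (n + 1) (a : ℝ)).natDegree ≤ n := by
        rw [natDegree_le_iff_coeff_eq_zero]
        intro N hN
        rw [coeff_sub, coeff_monomial]
        split_ifs with h
        · rw [← h, ← ha, sub_self]
        · rw [sub_zero, coeff_eq_zero_of_natDegree_lt (by omega)]
      obtain ⟨r, hr⟩ := ih _ hdeg
      have hmap : (r + monomial (n + 1) a).map (algebraMap ℚ ℝ) =
          r.map (algebraMap ℚ ℝ) + monomial (n + 1) (a : ℝ) := by simp
      refine ⟨r + monomial (n + 1) a, ?_⟩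
      rw [hmap]
      rcases hr with ⟨c, hc⟩ | ⟨i, q, hq, hi, hp⟩
      · exact Or.inl ⟨c, by rw [← add_assoc, ← hc, sub_add_cancel]⟩
      · exact Or.inr ⟨i, q, hq, hi, by rw [← add_assoc, ← hp, sub_add_cancel]⟩

/-- The sum of the b translates of u over one period is a constant function, whose mean is b · μ u
by invariance. -/
theorem IsInvariantMean.eq_of_periodic (hμ : IsInvariantMean μ) {u : ℤ →ᵇ ℂ} {b : ℕ} (hb : 0 < b)
    (hu : WeylDistal.shift b u = u) :
    μ u = (b : ℂ)⁻¹ * ∑ j ∈ Finset.range b, u j := by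
  have hper : ∀ n : ℤ, u (n + b) = u n := fun n => DFunLike.congr_fun hu n
  have hsum : ∑ j ∈ Finset.range b, WeylDistal.shift (j : ℤ) u =
      (∑ j ∈ Finset.range b, u j) • (1 : ℤ →ᵇ ℂ) := by
    let s : ℤ → ℂ := fun n => ∑ j ∈ Finset.range b, u (n + j)
    have hs : ∀ n, s (n + 1) = s n := by
      intro n
      have h1 := Finset.sum_range_succ (fun j : ℕ => u (n + j)) b
      rw [Finset.sum_range_succ', hper, Nat.cast_zero, add_zero] at h1
      refine Eq.trans (Finset.sum_congr rfl fun j _ => ?_) (add_right_cancel h1)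
      rw [Nat.cast_succ, add_assoc, add_comm 1 (j : ℤ)]
    have hs0 : ∀ n, s n = s 0 := by
      intro n
      induction n with
      | zero => rfl
      | succ n ih => rw [hs, ih]
      | pred n ih => rw [← ih, ← hs, sub_add_cancel]
    ext n
    have := hs0 n
    simp only [s, zero_add] at this
    simpa [BoundedContinuousFunction.sum_apply, shift_apply] using this
  have h := congrArg μ hsum
  simp only [map_sum, hμ.map_shift, map_smul, hμ.map_one, smul_eq_mul, mul_one, Finset.sum_const,
    Finset.card_range, nsmul_eq_mul] at h
  rw [← h, inv_mul_cancel_left₀ (by exact_mod_cast hb.ne')]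

theorem IsInvariantMean.phase_eq (hμ : IsInvariantMean μ) (hν : IsInvariantMean ν) (p : ℝ[X]) :
    μ (phase p) = ν (phase p) := by
  obtain ⟨r, ⟨c, rfl⟩ | ⟨i, q, hq, hi, rfl⟩⟩ := exists_rational_decomposition p
  · obtain ⟨b, hb, hr⟩ := exists_period r
    have hper : WeylDistal.shift b (phase (C c + r.map (algebraMap ℚ ℝ))) =
        phase (C c + r.map (algebraMap ℚ ℝ)) := by
      have h2 : taylor (b : ℝ) (C c + r.map (algebraMap ℚ ℝ)) =
          (taylor (b : ℝ) (r.map (algebraMap ℚ ℝ)) - r.map (algebraMap ℚ ℝ)) +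
            (C c + r.map (algebraMap ℚ ℝ)) := by
        rw [map_add, taylor_C]; ring
      rw [shift_phase, Int.cast_natCast, h2, phase_add, hr, one_mul]
    rw [hμ.eq_of_periodic hb hper, hν.eq_of_periodic hb hper]
  · rw [hμ.phase_eq_zero i q r hq hi, hν.phase_eq_zero i q r hq hi]

theorem continuous_shift (m : ℤ) : Continuous (shift m) :=
  BoundedContinuousFunction.continuous_compContinuous _

/-- All invariant means agree on the Weyl algebra. -/
theorem IsInvariantMean.eq_on_weylAlgebra (hμ : IsInvariantMean μ) (hν : IsInvariantMean ν)
    {f : ℤ →ᵇ ℂ}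
    (hf : f ∈ weylAlgebra) : μ f = ν f := by
  let S : Submonoid (ℤ →ᵇ ℂ) :=
    { carrier := Set.range phase
      one_mem' := ⟨0, phase_zero⟩
      mul_mem' := by
        rintro _ _ ⟨p, rfl⟩ ⟨q, rfl⟩
        exact ⟨p + q, phase_add p q⟩ }
  let A : Subalgebra ℂ (ℤ →ᵇ ℂ) := Algebra.adjoin ℂ (Set.range phase)
  -- The phases are closed under multiplication, so the algebra they generate is merely their linear
  -- span.
  have hA : (Subalgebra.toSubmodule A) = Submodule.span ℂ (Set.range phase) := by
    rw [Algebra.adjoin_eq_span]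
    congr 1
    exact congrArg _ (Submonoid.closure_eq S)
  have hle : weylAlgebra ≤ A.topologicalClosure := by
    refine sInf_le ⟨A.isClosed_topologicalClosure, fun m g hg => ?_, fun α k => ?_⟩
    · refine map_mem_closure (continuous_shift m) hg fun g hg => ?_
      change g ∈ Subalgebra.toSubmodule A at hg
      change WeylDistal.shift m g ∈ Subalgebra.toSubmodule A
      rw [hA] at hg ⊢
      induction hg using Submodule.span_induction with
      | mem x hx =>
        obtain ⟨p, rfl⟩ := hx
        exact Submodule.subset_span ⟨_, (shift_phase m p).symm⟩
      | zero => exact Submodule.zero_mem _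
      | add x y _ _ hx hy => exact Submodule.add_mem _ hx hy
      | smul a x _ hx => exact Submodule.smul_mem _ a hx
    · refine A.le_topologicalClosure (Algebra.subset_adjoin ⟨C α * X ^ k, ?_⟩)
      ext n
      rw [phase_apply, AddCircle.toCircle_apply_mk, Circle.coe_exp]
      change _ = Complex.exp _
      congr 1
      simp
      ring
  have hcont {κ : (ℤ →ᵇ ℂ) →ₗ[ℂ] ℂ} (hκ : IsInvariantMean κ) : Continuous κ :=
    (κ.mkContinuous 1 fun g => by
      rw [one_mul]; exact hκ.norm_le g).continuous
  have hcl : IsClosed {g : ℤ →ᵇ ℂ | μ g = ν g} := isClosed_eq (hcont hμ) (hcont hν)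
  refine hcl.closure_subset_iff.2 ?_ (hle hf)
  intro g hg
  change g ∈ Subalgebra.toSubmodule A at hg
  rw [hA] at hg
  refine LinearMap.eqOn_span (f := μ) (g := ν) ?_ hg
  rintro _ ⟨p, rfl⟩
  exact hμ.phase_eq hν p

end Mean

end WeylDistal

namespace WeylDistal

/-! ### Averages over long windows and their limits -/

section Windows

open Filter

/-- The average of `f` over the window `[a, a + N)`. -/
noncomputable def windowAverage (a : ℤ) (N : ℕ) (f : ℤ → ℂ) : ℂ :=
  (N : ℂ)⁻¹ * ∑ j ∈ Finset.range N, f (a + j)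

theorem norm_windowAverage_le {a : ℤ} {N : ℕ} {f : ℤ → ℂ} {C : ℝ} (hC : 0 ≤ C)
    (hf : ∀ n, ‖f n‖ ≤ C) : ‖windowAverage a N f‖ ≤ C := by
  rw [windowAverage, norm_mul, norm_inv, Complex.norm_natCast]
  rcases N.eq_zero_or_pos with rfl | hN
  · simpa using hC
  · rw [inv_mul_le_iff₀ (by positivity)]
    refine (norm_sum_le _ _).trans ((Finset.sum_le_sum fun j _ => hf _).trans ?_)
    simp

theorem norm_windowAverage_sq_le (a : ℤ) (N : ℕ) (f : ℤ →ᵇ ℂ) :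
    ‖windowAverage a N f‖ ^ 2 ≤ (windowAverage a N ⇑(star f * f)).re := by
  have h1 : (windowAverage a N ⇑(star f * f)).re =
      (N : ℝ)⁻¹ * ∑ j ∈ Finset.range N, ‖f (a + j)‖ ^ 2 := by
    have h2 : windowAverage a N ⇑(star f * f) =
        (((N : ℝ)⁻¹ * ∑ j ∈ Finset.range N, ‖f (a + j)‖ ^ 2 : ℝ) : ℂ) := by
      rw [windowAverage]
      push_cast
      congr 1
      refine Finset.sum_congr rfl fun j _ => ?_
      rw [BoundedContinuousFunction.mul_apply, BoundedContinuousFunction.star_apply]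
      exact Complex.conj_mul' _
    rw [h2, Complex.ofReal_re]
  rw [h1, windowAverage, norm_mul, norm_inv, Complex.norm_natCast, mul_pow]
  rcases N.eq_zero_or_pos with rfl | hN
  · simp
  · have h3 : ‖∑ j ∈ Finset.range N, f (a + j)‖ ^ 2 ≤
        N * ∑ j ∈ Finset.range N, ‖f (a + j)‖ ^ 2 := by
      refine (pow_le_pow_left₀ (norm_nonneg _) (norm_sum_le _ _) 2).trans ?_
      simpa using sq_sum_le_card_mul_sum_sq (s := Finset.range N) (f := fun j => ‖f (a + j)‖)
    have hN' : (0 : ℝ) < N := by exact_mod_cast hN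
    calc (N : ℝ)⁻¹ ^ 2 * ‖∑ j ∈ Finset.range N, f (a + j)‖ ^ 2
        ≤ (N : ℝ)⁻¹ ^ 2 * (N * ∑ j ∈ Finset.range N, ‖f (a + j)‖ ^ 2) := by gcongr
      _ = _ := by field_simp

/-- The difference telescopes to two end terms; this makes limits along long windows invariant. -/
theorem norm_windowAverage_succ_sub_le {a : ℤ} {N : ℕ} {f : ℤ → ℂ} {C : ℝ}
    (hf : ∀ n, ‖f n‖ ≤ C) :
    ‖windowAverage a N (fun n => f (n + 1)) - windowAverage a N f‖ ≤ 2 * C * (N : ℝ)⁻¹ := by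
  have h1 := Finset.sum_range_succ (fun j : ℕ => f (a + j)) N
  rw [Finset.sum_range_succ'] at h1
  have h2 : windowAverage a N (fun n => f (n + 1)) - windowAverage a N f =
      (N : ℂ)⁻¹ * (f (a + N) - f a) := by
    rw [windowAverage, windowAverage, ← mul_sub]
    congr 1
    simp only [Nat.cast_add, Nat.cast_one, Nat.cast_zero, add_zero, ← add_assoc] at h1
    linear_combination h1
  rw [h2, norm_mul, norm_inv, Complex.norm_natCast, mul_comm]
  gcongr
  calc ‖f (a + N) - f a‖ ≤ ‖f (a + N)‖ + ‖f a‖ := norm_sub_le _ _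
    _ ≤ 2 * C := by linarith [hf (a + N), hf a]

/-- Averages over long windows have a limit point that is an invariant mean. -/
theorem exists_isInvariantMean (a : ℕ → ℤ) (N : ℕ → ℕ) (hN : Tendsto N atTop atTop) :
    ∃ μ : (ℤ →ᵇ ℂ) →ₗ[ℂ] ℂ, IsInvariantMean μ ∧ ∀ f : ℤ →ᵇ ℂ,
      Tendsto (fun k => windowAverage (a k) (N k) f) (hyperfilter ℕ) (𝓝 (μ f)) := by
  have hbound (f : ℤ →ᵇ ℂ) (k : ℕ) : ‖windowAverage (a k) (N k) f‖ ≤ ‖f‖ :=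
    norm_windowAverage_le (norm_nonneg _) fun n => f.norm_coe_le_norm n
  -- The averages of f stay in a compact disc, so they converge along the ultrafilter. Using one
  -- ultrafilter for all f makes the limit linear.
  have hex (f : ℤ →ᵇ ℂ) : ∃ c : ℂ,
      Tendsto (fun k => windowAverage (a k) (N k) f) (hyperfilter ℕ) (𝓝 c) := by
    obtain ⟨c, -, hc⟩ := (isCompact_closedBall (0 : ℂ) ‖f‖).ultrafilter_le_nhds
      ((hyperfilter ℕ).map fun k => windowAverage (a k) (N k) f) (by
        rw [Ultrafilter.coe_map, le_principal_iff, mem_map]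
        exact univ_mem' fun k => by simpa using hbound f k)
    exact ⟨c, hc⟩
  choose m hm using hex
  have hinv : Tendsto (fun k => (N k : ℝ)⁻¹) (hyperfilter ℕ) (𝓝 0) :=
    (tendsto_inv_atTop_zero.comp (tendsto_natCast_atTop_atTop.comp hN)).mono_left
      Nat.hyperfilter_le_atTop
  have hshift (f : ℤ →ᵇ ℂ) : m (shift 1 f) = m f := by
    refine sub_eq_zero.1 (tendsto_nhds_unique ((hm (shift 1 f)).sub (hm f)) ?_)
    refine squeeze_zero_norm
      (fun k => norm_windowAverage_succ_sub_le fun n => f.norm_coe_le_norm n) ?_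
    simpa using hinv.const_mul (2 * ‖f‖)
  have hpos : ∀ᶠ k in (hyperfilter ℕ : Filter ℕ), 0 < N k :=
    (hN.eventually_gt_atTop 0).filter_mono Nat.hyperfilter_le_atTop
  refine ⟨{ toFun := m, map_add' := fun f g => ?_, map_smul' := fun c f => ?_ },
    ⟨?_, ?_, fun f => ?_, fun f => ?_⟩, hm⟩
  · refine tendsto_nhds_unique (hm _) (((hm f).add (hm g)).congr fun k => ?_)
    simp [windowAverage, Finset.sum_add_distrib, mul_add]
  · refine tendsto_nhds_unique (hm _) (((hm f).const_mul c).congr fun k => ?_)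
    simp only [windowAverage, BoundedContinuousFunction.coe_smul, smul_eq_mul, ← Finset.mul_sum]
    ring
  · refine tendsto_nhds_unique (hm 1) (tendsto_const_nhds.congr' ?_)
    filter_upwards [hpos] with k hk
    have : (N k : ℂ) ≠ 0 := by exact_mod_cast hk.ne'
    simp [windowAverage, this]
  · intro k
    change ∀ f, m (shift k f) = m f
    have hadd (k l : ℤ) (f : ℤ →ᵇ ℂ) : shift (k + l) f = shift k (shift l f) := by
      ext n
      simp [shift_apply, add_assoc]
    induction k with
    | zero =>
      intro f
      congr 1
      ext n
      simp [shift_apply]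
    | succ k ih => exact fun f => by rw [hadd, ih, hshift]
    | pred k ih =>
      intro f
      rw [← ih f, show -(k : ℤ) = 1 + (-(k : ℤ) - 1) by ring, hadd 1, hshift]
      congr 2
      ring
  · exact le_of_tendsto (hm f).norm (univ_mem' fun k => hbound f k)
  · exact le_of_tendsto_of_tendsto ((hm f).norm.pow 2)
      ((Complex.continuous_re.tendsto _).comp (hm (star f * f)))
      (univ_mem' fun k => norm_windowAverage_sq_le _ _ f)

/-- Averages of a function in the Weyl algebra over long windows cannot be separated. -/
theorem not_mem_weylAlgebra_of_windowAverage {f : ℤ →ᵇ ℂ} {N : ℕ → ℕ}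
    (hN : Tendsto N atTop atTop) {a b : ℕ → ℤ} {c : ℝ} (hc : 0 < c)
    (ha : ∀ k, c ≤ (windowAverage (a k) (N k) f).re)
    (hb : ∀ k, (windowAverage (b k) (N k) f).re ≤ -c) : f ∉ weylAlgebra := by
  intro hf
  obtain ⟨μ, hμ, hμl⟩ := exists_isInvariantMean a N hN
  obtain ⟨ν, hν, hνl⟩ := exists_isInvariantMean b N hN
  have h1 : c ≤ (μ f).re :=
    ge_of_tendsto' ((Complex.continuous_re.tendsto _).comp (hμl f)) ha
  have h2 : (ν f).re ≤ -c :=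
    le_of_tendsto' ((Complex.continuous_re.tendsto _).comp (hνl f)) hb
  rw [hμ.eq_on_weylAlgebra hν hf] at h1
  linarith

/-- If a continuous function on a minimal flow has long averages separated by `0`, then no point
of the flow has its functions in the Weyl algebra. -/
theorem not_flowAlgebra_subset_weylAlgebra {X : Type*} [TopologicalSpace X] [CompactSpace X]
    {T : X ≃ₜ X} (hT : IsMinimalFlow T) (F : C(X, ℂ)) {N : ℕ → ℕ} (hN : Tendsto N atTop atTop)
    {y z : ℕ → X} {c : ℝ} (hc : 0 < c)
    (hy : ∀ k, c < (windowAverage 0 (N k) fun n => F ((T ^ n) (y k))).re)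
    (hz : ∀ k, (windowAverage 0 (N k) fun n => F ((T ^ n) (z k))).re < -c) (x : X) :
    ¬ flowAlgebra T x ⊆ (weylAlgebra : Set (ℤ →ᵇ ℂ)) := by
  let f : ℤ →ᵇ ℂ := BoundedContinuousFunction.ofNormedAddCommGroupDiscrete
    (fun n => F ((T ^ n) x)) ‖F‖ fun n => F.norm_coe_le_norm _
  -- A fixed-length average depends continuously on the starting point, so the strict inequalities
  -- at `y k` and `z k` persist at points of the dense orbit of x, where they concern windows of one
  -- function on ℤ.
  have hcont (k : ℕ) : Continuous fun w =>
      (windowAverage 0 (N k) fun n => F ((T ^ n) w)).re := by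
    unfold windowAverage
    refine Complex.continuous_re.comp (continuous_const.mul (continuous_finsetSum _ fun j _ => ?_))
    exact F.continuous.comp (T ^ (0 + (j : ℤ))).continuous
  have hval (k : ℕ) (m : ℤ) : (windowAverage 0 (N k) fun n => F ((T ^ n) ((T ^ m) x))) =
      windowAverage m (N k) f := by
    unfold windowAverage
    congr 1
    refine Finset.sum_congr rfl fun j _ => ?_
    change F ((T ^ (0 + (j : ℤ))) ((T ^ m) x)) = F ((T ^ (m + (j : ℤ))) x)
    rw [zero_add, add_comm, zpow_add, Homeomorph.mul_apply]
  have h1 (k : ℕ) : ∃ m : ℤ, c ≤ (windowAverage m (N k) f).re := by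
    obtain ⟨_, h, ⟨m, rfl⟩⟩ := dense_iff_inter_open.1 (hT.dense_orbit x) _
      (isOpen_lt continuous_const (hcont k)) ⟨y k, hy k⟩
    exact ⟨m, by rw [← hval]; exact le_of_lt h⟩
  have h2 (k : ℕ) : ∃ m : ℤ, (windowAverage m (N k) f).re ≤ -c := by
    obtain ⟨_, h, ⟨m, rfl⟩⟩ := dense_iff_inter_open.1 (hT.dense_orbit x) _
      (isOpen_lt (hcont k) continuous_const) ⟨z k, hz k⟩
    exact ⟨m, by rw [← hval]; exact le_of_lt h⟩
  choose a ha using h1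
  choose b hb using h2
  exact fun h => not_mem_weylAlgebra_of_windowAverage hN hc ha hb (h ⟨F, fun n => rfl⟩)

end Windows

/-! ### Invariant measures from empirical averages -/

section Measures

open Filter MeasureTheory

/-- A limit point of the empirical measures along long windows is an invariant measure. -/
theorem exists_invariant_measure_integral {X : Type*} [MetricSpace X] [CompactSpace X]
    [MeasurableSpace X] [BorelSpace X] (T : X ≃ₜ X) {N : ℕ → ℕ} (hN : Tendsto N atTop atTop)
    (y : ℕ → X) (F : C(X, ℂ)) {c : ℝ} (hc : 0 < c)
    (hy : ∀ k, c < (windowAverage 0 (N k) fun n => F ((T ^ n) (y k))).re) :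
    ∃ μ : Measure X, IsProbabilityMeasure μ ∧ μ.Regular ∧ MeasurePreserving T μ μ ∧
      c ≤ (∫ x, F x ∂μ).re := by
  -- The average over an empty window is 0, which is not above c.
  have hN0 (k : ℕ) : N k ≠ 0 := by
    intro h
    have := hy k
    rw [windowAverage, h] at this
    simp at this
    linarith
  let e (k : ℕ) : Measure X :=
    (N k : ENNReal)⁻¹ • ∑ j ∈ Finset.range (N k), Measure.dirac ((T ^ (j : ℤ)) (y k))
  have he (k : ℕ) : IsProbabilityMeasure (e k) := by
    constructor
    simp only [e, Measure.smul_apply, Measure.finsetSum_apply, measure_univ, smul_eq_mul,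
      Finset.sum_const, Finset.card_range, nsmul_eq_mul, mul_one]
    exact ENNReal.inv_mul_cancel (by exact_mod_cast hN0 k) (ENNReal.natCast_ne_top _)
  have hint (k : ℕ) (G : X →ᵇ ℂ) :
      ∫ x, G x ∂(e k) = windowAverage 0 (N k) fun n => G ((T ^ n) (y k)) := by
    simp only [e]
    rw [integral_smul_measure, integral_finsetSum_measure fun j _ => by
      exact G.integrable _]
    simp only [integral_dirac, windowAverage, zero_add]
    simp [Complex.real_smul]
  obtain ⟨μ, -, hμ⟩ := (isCompact_univ (X := ProbabilityMeasure X)).ultrafilter_le_nhds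
    ((hyperfilter ℕ).map fun k => (⟨e k, he k⟩ : ProbabilityMeasure X)) (by simp)
  have hlim : ∀ G : X →ᵇ ℂ, Tendsto (fun k => windowAverage 0 (N k) fun n => G ((T ^ n) (y k)))
      (hyperfilter ℕ) (𝓝 (∫ x, G x ∂(μ : Measure X))) := by
    intro G
    refine ((ProbabilityMeasure.tendsto_iff_forall_integral_rclike_tendsto ℂ).1 hμ G).congr
      fun k => hint k G
  have hinv : Tendsto (fun k => (N k : ℝ)⁻¹) (hyperfilter ℕ) (𝓝 0) :=
    (tendsto_inv_atTop_zero.comp (tendsto_natCast_atTop_atTop.comp hN)).mono_left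
      Nat.hyperfilter_le_atTop
  have hT (G : X →ᵇ ℂ) : ∫ x, G (T x) ∂(μ : Measure X) = ∫ x, G x ∂(μ : Measure X) := by
    have h1 := (hlim (G.compContinuous ⟨T, T.continuous⟩)).sub (hlim G)
    refine sub_eq_zero.1 (tendsto_nhds_unique h1 (squeeze_zero_norm (fun k => ?_)
      (by simpa using hinv.const_mul (2 * ‖G‖))))
    have h2 := norm_windowAverage_succ_sub_le (a := 0) (N := N k)
      (f := fun n => G ((T ^ n) (y k))) fun n => G.norm_coe_le_norm _
    refine le_trans (le_of_eq ?_) h2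
    congr 3
    funext n
    change G (T ((T ^ n) (y k))) = _
    rw [add_comm, zpow_add, zpow_one, Homeomorph.mul_apply]
  have hTm : Measurable T := T.continuous.measurable
  refine ⟨μ, inferInstance, inferInstance, ⟨hTm, ?_⟩, ?_⟩
  · have := Measure.isFiniteMeasure_map (μ : Measure X) T
    refine ext_of_forall_integral_eq_of_IsFiniteMeasure fun G => ?_
    rw [integral_map hTm.aemeasurable G.continuous.aestronglyMeasurable]
    have h := hT (BoundedContinuousFunction.mkOfCompact
      ⟨fun x => (G x : ℂ), Complex.continuous_ofReal.comp G.continuous⟩)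
    simp only [BoundedContinuousFunction.mkOfCompact_apply, ContinuousMap.coe_mk] at h
    rw [integral_complex_ofReal, integral_complex_ofReal] at h
    exact_mod_cast h
  · exact ge_of_tendsto' ((Complex.continuous_re.tendsto _).comp
      (hlim (BoundedContinuousFunction.mkOfCompact F))) fun k => (hy k).le

/-- If a homeomorphism `R` commuting with `T` changes the sign of a function with averages bounded
away from zero, then `T` is not uniquely ergodic. -/
theorem not_isUniquelyErgodic_of_windowAverage {X : Type*} [MetricSpace X] [CompactSpace X]
    [MeasurableSpace X] [BorelSpace X] {T R : X ≃ₜ X} (hTR : ∀ x, T (R x) = R (T x))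
    {N : ℕ → ℕ} (hN : Tendsto N atTop atTop) (y : ℕ → X) (F : C(X, ℂ)) {c : ℝ} (hc : 0 < c)
    (hy : ∀ k, c < (windowAverage 0 (N k) fun n => F ((T ^ n) (y k))).re)
    (hR : ∀ x, F (R x) = - F x) : ¬ IsUniquelyErgodic T := by
  rintro ⟨μ₀, -, huniq⟩
  obtain ⟨μ, hμ, hreg, hT, hF⟩ := exists_invariant_measure_integral T hN y F hc hy
  have hRm : Measurable R := R.continuous.measurable
  have hprob : IsProbabilityMeasure (μ.map R) := Measure.isProbabilityMeasure_map hRm.aemeasurable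
  have hT' : MeasurePreserving T (μ.map R) (μ.map R) := by
    refine ⟨hT.measurable, ?_⟩
    rw [Measure.map_map hT.measurable hRm]
    conv_rhs => rw [← hT.map_eq, Measure.map_map hRm hT.measurable]
    congr 1
    exact funext hTR
  have h := (huniq (μ.map R) ⟨hprob, inferInstance, hT'⟩).trans (huniq μ ⟨hμ, hreg, hT⟩).symm
  have h1 : ∫ x, F x ∂μ = -∫ x, F x ∂μ := by
    conv_lhs => rw [← h]
    rw [integral_map hRm.aemeasurable F.continuous.aestronglyMeasurable, ← integral_neg]
    simp only [hR]
  have h2 := congrArg Complex.re h1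
  rw [Complex.neg_re] at h2
  linarith

end Measures

end WeylDistal

namespace WeylDistal

/-! ### A minimal distal flow that is not uniquely ergodic

A skew product over the `2`-adic odometer, with a cocycle that is a sum of small coboundaries of
functions that are supported on sets of small density. -/

section Odometer

open Filter PadicInt

/-- The periods of the successive ramps. -/
def blockLength (i : ℕ) : ℕ := 2 ^ (i + 1) ^ 2

/-- The number of steps in which the `i`-th ramp winds once around the circle. -/
def rampLength (i : ℕ) : ℕ := 2 ^ ((i + 1) ^ 2 + i)

/-- The function on the `2`-adic integers, of period `blockLength (i + 1)`, that winds once around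
the circle in the first `rampLength i` steps and vanishes in the remaining ones. -/
noncomputable def ramp (i : ℕ) (x : ℤ_[2]) : UnitAddCircle :=
  (((min (toZModPow ((i + 2) ^ 2) x).val (rampLength i) : ℕ) : ℝ) / rampLength i : ℝ)

theorem blockLength_pos (i : ℕ) : 0 < blockLength i := by unfold blockLength; positivity

theorem rampLength_pos (i : ℕ) : 0 < rampLength i := by unfold rampLength; positivity

theorem blockLength_dvd {i j : ℕ} (h : i ≤ j) : blockLength i ∣ blockLength j :=
  pow_dvd_pow 2 (Nat.pow_le_pow_left (by omega) 2)

theorem rampLength_eq (i : ℕ) : rampLength i = blockLength i * 2 ^ i := pow_add _ _ _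

/-- Here (i + 2)² = (i + 1)² + i + (i + 3). The factor 2^(i+3) is the inverse of the density of the
winding part of the ramp, while the factor 2^i in `rampLength_eq` makes the ramp flat at scale Lᵢ.
-/
theorem blockLength_succ (i : ℕ) : blockLength (i + 1) = rampLength i * 2 ^ (i + 3) := by
  rw [blockLength, rampLength, ← pow_add]
  congr 1
  ring

theorem rampLength_le (i : ℕ) : rampLength i ≤ blockLength (i + 1) := by
  rw [blockLength_succ]
  exact Nat.le_mul_of_pos_right _ (by positivity)

theorem blockLength_div_le {m i : ℕ} (h : m ≤ i) :
    (blockLength m : ℝ) / rampLength i ≤ (1 / 2) ^ i := by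
  have h1 : (blockLength m : ℝ) ≤ blockLength i := by
    exact_mod_cast Nat.le_of_dvd (blockLength_pos i) (blockLength_dvd h)
  have h2 : (0 : ℝ) < blockLength i := by exact_mod_cast blockLength_pos i
  rw [rampLength_eq]
  push_cast
  rw [div_le_iff₀ (by positivity), one_div, inv_pow, mul_comm (blockLength i : ℝ),
    inv_mul_cancel_left₀ (by positivity)]
  exact h1

theorem ramp_add_intCast {i : ℕ} {n : ℤ} (h : (blockLength (i + 1) : ℤ) ∣ n) (x : ℤ_[2]) :
    ramp i (x + n) = ramp i x := by
  have : (toZModPow ((i + 2) ^ 2) (n : ℤ_[2])) = 0 := by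
    rw [map_intCast]
    exact (ZMod.intCast_zmod_eq_zero_iff_dvd _ _).2 h
  rw [ramp, map_add, this, add_zero, ramp]

theorem ramp_natCast {i v : ℕ} (h : v < blockLength (i + 1)) :
    ramp i v = (((min v (rampLength i) : ℕ) : ℝ) / rampLength i : ℝ) := by
  rw [ramp, map_natCast, ZMod.val_natCast_of_lt (by exact h)]

theorem ramp_natCast_of_le {i v : ℕ} (h : v < blockLength (i + 1)) (hv : rampLength i ≤ v) :
    ramp i v = 0 := by
  rw [ramp_natCast h, min_eq_right hv, div_self (by exact_mod_cast (rampLength_pos i).ne')]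
  exact AddCircle.coe_period 1

theorem ramp_zero (i : ℕ) : ramp i 0 = 0 := by
  have := ramp_natCast (blockLength_pos (i + 1))
  simpa using this

theorem exists_ramp_eq_natCast (i : ℕ) (x : ℤ_[2]) : ∃ v < blockLength (i + 1),
    ∀ n : ℤ, ramp i (x + n) = ramp i ((v : ℤ_[2]) + n) := by
  have : NeZero (2 ^ (i + 2) ^ 2) := ⟨by positivity⟩
  refine ⟨(toZModPow ((i + 2) ^ 2) x).val, ZMod.val_lt _, fun n => ?_⟩
  rw [ramp, ramp, map_add, map_add, map_natCast, ZMod.natCast_zmod_val]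

theorem continuous_ramp (i : ℕ) : Continuous (ramp i) := by
  have h : IsLocallyConstant (ramp i) := by
    rw [IsLocallyConstant.iff_eventually_eq]
    intro x
    filter_upwards [Metric.ball_mem_nhds x
      (show (0 : ℝ) < ((2 : ℕ) : ℝ) ^ (-((i + 2) ^ 2 : ℕ) : ℤ) by positivity)] with y hy
    rw [Metric.mem_ball, dist_eq_norm] at hy
    have h1 := (norm_le_pow_iff_mem_span_pow (y - x) ((i + 2) ^ 2)).1 hy.le
    rw [← ker_toZModPow, RingHom.mem_ker, map_sub, sub_eq_zero] at h1
    rw [ramp, ramp, h1]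
  exact h.continuous

theorem norm_coe_unitAddCircle_le (r : ℝ) : ‖(r : UnitAddCircle)‖ ≤ |r| := by
  rw [UnitAddCircle.norm_eq]
  simpa using round_le r 0

theorem norm_ramp_add_one_sub_le (i : ℕ) (x : ℤ_[2]) :
    ‖ramp i (x + 1) - ramp i x‖ ≤ 1 / rampLength i := by
  obtain ⟨v, hv, h⟩ := exists_ramp_eq_natCast i x
  have h0 := h 0
  have h1 := h 1
  rw [Int.cast_zero, add_zero, add_zero] at h0
  rw [Int.cast_one] at h1
  rw [h0, h1]
  have hw : (0 : ℝ) < rampLength i := by exact_mod_cast rampLength_pos i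
  rcases (Nat.succ_le_of_lt hv).lt_or_eq with hlt | heq
  · rw [← Nat.cast_succ, ramp_natCast hlt, ramp_natCast hv, ← AddCircle.coe_sub, ← sub_div]
    refine (norm_coe_unitAddCircle_le _).trans ?_
    rw [abs_div, abs_of_pos hw]
    gcongr
    rcases le_total (rampLength i) v with hle | hle
    · simp [hle, hle.trans (Nat.le_succ v)]
    · rw [min_eq_left hle]
      rcases hle.eq_or_lt with heq | hlt
      · simp [heq]
      · rw [min_eq_left (Nat.succ_le_of_lt hlt)]
        simp
  -- At the end of a period the ramp has completed its turn, so its value is 0 on the circle and the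
  -- return to the start causes no jump.
  · have hle : rampLength i ≤ v := by
      have h2 := blockLength_succ i
      have h3 := rampLength_pos i
      have h4 : rampLength i * 2 ≤ rampLength i * 2 ^ (i + 3) :=
        Nat.mul_le_mul_left _ (Nat.le_self_pow (by omega) 2)
      omega
    have h5 : ramp i ((v : ℤ_[2]) + 1) = 0 := by
      rw [← ramp_zero i, ← ramp_add_intCast (n := (blockLength (i + 1) : ℕ)) dvd_rfl 0, ← heq]
      simp
    rw [h5, ramp_natCast_of_le hv hle, sub_zero, norm_zero]
    positivity

theorem norm_ramp_add_sub_le (i : ℕ) (n : ℤ) (x : ℤ_[2]) :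
    ‖ramp i (x + n) - ramp i x‖ ≤ |(n : ℝ)| / rampLength i := by
  have hnat : ∀ (n : ℕ) (x : ℤ_[2]), ‖ramp i (x + n) - ramp i x‖ ≤ n / rampLength i := by
    intro n
    induction n with
    | zero => simp
    | succ n ih =>
      intro x
      have h1 := norm_ramp_add_one_sub_le i (x + n)
      have h2 := ih x
      have h3 : ramp i (x + (n + 1 : ℕ)) - ramp i x =
          (ramp i (x + n + 1) - ramp i (x + n)) + (ramp i (x + n) - ramp i x) := by
        rw [sub_add_sub_cancel, Nat.cast_succ, add_assoc]
      rw [h3]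
      refine (norm_add_le _ _).trans ((add_le_add h1 h2).trans (le_of_eq ?_))
      push_cast
      ring
  obtain ⟨n, rfl | rfl⟩ := n.eq_nat_or_neg
  · simpa using hnat n x
  · have h1 := hnat n (x + (-(n : ℤ) : ℤ))
    rw [norm_sub_rev]
    simpa using h1

theorem summable_inv_rampLength : Summable fun i => (1 : ℝ) / rampLength i := by
  refine Summable.of_nonneg_of_le (fun i => by positivity) (fun i => ?_)
    (summable_geometric_of_lt_one (r := (1 / 2 : ℝ)) (by norm_num) (by norm_num))
  refine le_trans ?_ (blockLength_div_le (Nat.zero_le i))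
  gcongr
  exact_mod_cast blockLength_pos 0

theorem summable_rampDiff (n : ℤ) (x : ℤ_[2]) :
    Summable fun i => ramp i (x + n) - ramp i x := by
  refine Summable.of_norm_bounded (summable_inv_rampLength.mul_left |(n : ℝ)|) fun i => ?_
  rw [mul_one_div]
  exact norm_ramp_add_sub_le i n x

/-! ### The cocycle, the skew product and minimality -/

/-- The cocycle of the skew product. -/
noncomputable def cocycle (n : ℤ) (x : ℤ_[2]) : UnitAddCircle :=
  ∑' i, (ramp i (x + n) - ramp i x)

theorem continuous_cocycle (n : ℤ) : Continuous (cocycle n) := by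
  refine continuous_tsum (fun i => ?_) (summable_inv_rampLength.mul_left |(n : ℝ)|) fun i x => ?_
  · exact ((continuous_ramp i).comp (continuous_id.add continuous_const)).sub (continuous_ramp i)
  · rw [mul_one_div]
    exact norm_ramp_add_sub_le i n x

theorem cocycle_zero (x : ℤ_[2]) : cocycle 0 x = 0 := by simp [cocycle]

theorem cocycle_add (m n : ℤ) (x : ℤ_[2]) :
    cocycle (m + n) x = cocycle m (x + n) + cocycle n x := by
  rw [cocycle, cocycle, cocycle, ← (summable_rampDiff m (x + n)).tsum_add (summable_rampDiff n x)]
  refine tsum_congr fun i => ?_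
  rw [sub_add_sub_cancel, Int.cast_add, add_assoc, add_comm (n : ℤ_[2])]

/-- The iterates of the skew product. -/
noncomputable def skewMap (n : ℤ) (p : ℤ_[2] × UnitAddCircle) : ℤ_[2] × UnitAddCircle :=
  (p.1 + n, p.2 + cocycle n p.1)

theorem skewMap_zero (p : ℤ_[2] × UnitAddCircle) : skewMap 0 p = p := by
  simp [skewMap, cocycle_zero]

theorem skewMap_add (m n : ℤ) (p : ℤ_[2] × UnitAddCircle) :
    skewMap m (skewMap n p) = skewMap (m + n) p := by
  simp only [skewMap, cocycle_add, Int.cast_add, Prod.mk.injEq]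
  constructor <;> abel

theorem continuous_skewMap (n : ℤ) : Continuous (skewMap n) :=
  (continuous_fst.add continuous_const).prodMk
    (continuous_snd.add ((continuous_cocycle n).comp continuous_fst))

/-- The skew product over the odometer. -/
noncomputable def skewFlow : (ℤ_[2] × UnitAddCircle) ≃ₜ (ℤ_[2] × UnitAddCircle) where
  toFun := skewMap 1
  invFun := skewMap (-1)
  left_inv p := by rw [skewMap_add]; exact skewMap_zero p
  right_inv p := by rw [skewMap_add]; exact skewMap_zero p
  continuous_toFun := continuous_skewMap 1
  continuous_invFun := continuous_skewMap (-1)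

theorem skewFlow_zpow (n : ℤ) (p : ℤ_[2] × UnitAddCircle) : (skewFlow ^ n) p = skewMap n p := by
  induction n with
  | zero => exact (skewMap_zero p).symm
  | succ n ih =>
    rw [add_comm, zpow_add, Homeomorph.mul_apply, ih, zpow_one, ← skewMap_add]
    rfl
  | pred n ih =>
    rw [sub_eq_neg_add, zpow_add, Homeomorph.mul_apply, ih, zpow_neg_one, ← skewMap_add]
    rfl

theorem isDistalFlow_skewFlow : IsDistalFlow skewFlow := by
  intro p q hpq
  by_cases h : p.1 = q.1
  · have h2 : p.2 - q.2 ≠ 0 := fun h2 => hpq (Prod.ext h (sub_eq_zero.1 h2))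
    refine ⟨{u | u.1.2 - u.2.2 ≠ p.2 - q.2}, ?_, fun n hn => hn ?_⟩
    · refine (isOpen_ne_fun (by fun_prop) continuous_const).mem_nhdsSet.2 ?_
      rintro ⟨u, v⟩ huv
      obtain rfl : u = v := huv
      change u.2 - u.2 ≠ _
      rw [sub_self]
      exact h2.symm
    · simp [skewFlow_zpow, skewMap, h]
  · refine ⟨{u | u.1.1 - u.2.1 ≠ p.1 - q.1}, ?_, fun n hn => hn ?_⟩
    · refine (isOpen_ne_fun (by fun_prop) continuous_const).mem_nhdsSet.2 ?_
      rintro ⟨u, v⟩ huv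
      obtain rfl : u = v := huv
      change u.1 - u.1 ≠ _
      rw [sub_self]
      exact (sub_ne_zero.2 h).symm
    · simp [skewFlow_zpow, skewMap]

/-- For multiples of `blockLength m` that are not too long, the cocycle is governed by the `m`-th
ramp. -/
theorem norm_cocycle_sub_le {m : ℕ} {n : ℤ} (hd : (blockLength m : ℤ) ∣ n)
    (hn : |(n : ℝ)| ≤ blockLength (m + 1)) (x : ℤ_[2]) :
    ‖cocycle n x - (ramp m (x + n) - ramp m x)‖ ≤ (1 / 2) ^ m := by
  rw [cocycle, (summable_rampDiff n x).tsum_eq_add_tsum_ite m, add_sub_cancel_left]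
  -- Majorant of the series without its m-th term: terms with i < m vanish by periodicity, and those
  -- with i > m are at most Lₘ₊₁ / wᵢ ≤ 2^(-i).
  have hgeom : HasSum (fun i => if i ≤ m then 0 else (1 / 2 : ℝ) ^ i) ((1 / 2) ^ m) := by
    have h1 := (hasSum_geometric_of_lt_one (r := (1 / 2 : ℝ)) (by norm_num) (by norm_num)).mul_left
      ((1 / 2 : ℝ) ^ (m + 1))
    rw [show (1 / 2 : ℝ) ^ (m + 1) * (1 - 1 / 2)⁻¹ = (1 / 2) ^ m by
        rw [pow_succ]
        ring] at h1
    have h2 : (fun i => if i + (m + 1) ≤ m then 0 else (1 / 2 : ℝ) ^ (i + (m + 1))) =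
        fun i => (1 / 2) ^ (m + 1) * (1 / 2) ^ i := by
      funext i
      rw [if_neg (by omega), pow_add, mul_comm]
    rw [← h2] at h1
    have h3 := (hasSum_nat_add_iff (f := fun i => if i ≤ m then 0 else (1 / 2 : ℝ) ^ i) (m + 1)).1 h1
    rwa [Finset.sum_eq_zero fun i hi => if_pos (by simpa [Nat.lt_succ_iff] using hi),
      add_zero] at h3
  refine tsum_of_norm_bounded hgeom fun i => ?_
  rcases lt_trichotomy i m with h | rfl | h
  · rw [if_neg h.ne, if_pos h.le, ramp_add_intCast, sub_self, norm_zero]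
    exact dvd_trans (by exact_mod_cast blockLength_dvd h) hd
  · simp
  · rw [if_neg h.ne', if_neg (not_le.2 h)]
    refine (norm_ramp_add_sub_le i n x).trans (le_trans ?_ (blockLength_div_le h))
    gcongr

/-- The winding part has length wₘ = Lₘ 2^m, so each residue class modulo Lₘ meets it in 2^m points,
whose ramp values are spaced by 2^(-m). -/
theorem exists_norm_ramp_sub_le (m : ℕ) (x : ℤ_[2]) (t : UnitAddCircle) :
    ∃ n : ℤ, (blockLength m : ℤ) ∣ n ∧ |(n : ℝ)| ≤ blockLength (m + 1) ∧
      ‖ramp m (x + n) - t‖ ≤ (1 / 2) ^ m := by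
  obtain ⟨v, hv, h⟩ := exists_ramp_eq_natCast m x
  obtain ⟨s, hs, rfl⟩ : ∃ s ∈ Set.Ico (0 : ℝ) 1, (s : UnitAddCircle) = t := by
    obtain ⟨s, hs⟩ := (AddCircle.equivIco 1 0).symm.surjective t
    exact ⟨s, by simpa using s.2, hs⟩
  have hL := blockLength_pos m
  set k := ⌊s * 2 ^ m⌋₊ with hk
  have hs0 : 0 ≤ s * 2 ^ m := mul_nonneg hs.1 (by positivity)
  have hk1 : (k : ℝ) ≤ s * 2 ^ m := Nat.floor_le hs0
  have hk2 : s * 2 ^ m < k + 1 := Nat.lt_floor_add_one _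
  have hk3 : k < 2 ^ m := by
    have : (k : ℝ) < ((2 ^ m : ℕ) : ℝ) := by
      push_cast
      exact hk1.trans_lt (mul_lt_of_lt_one_left (by positivity) hs.2)
    exact_mod_cast this
  -- The point in the residue class of v whose block index along the ramp is ⌊s 2^m⌋.
  set v' := v % blockLength m + blockLength m * k with hv'
  have hmod : v % blockLength m < blockLength m := Nat.mod_lt _ hL
  have hlt : v' < rampLength m := by
    rw [rampLength_eq]
    calc v' < blockLength m * (k + 1) := by rw [mul_add, mul_one]; omega
      _ ≤ _ := Nat.mul_le_mul_left _ hk3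
  have hlt' : v' < blockLength (m + 1) := hlt.trans_le (rampLength_le m)
  refine ⟨(v' : ℤ) - v, ?_, ?_, ?_⟩
  · refine ⟨k - (v / blockLength m : ℕ), ?_⟩
    have h1 := Nat.mod_add_div v (blockLength m)
    have h2 : (v : ℤ) = (v % blockLength m : ℕ) + blockLength m * (v / blockLength m : ℕ) := by
      exact_mod_cast h1.symm
    rw [hv', h2]
    push_cast
    ring
  · have h1 : (v : ℝ) < blockLength (m + 1) := by exact_mod_cast hv
    have h2 : (v' : ℝ) < blockLength (m + 1) := by exact_mod_cast hlt'
    have h3 : (0 : ℝ) ≤ v := by positivity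
    have h4 : (0 : ℝ) ≤ v' := by positivity
    push_cast
    rw [abs_le]
    constructor <;> linarith
  · rw [h]
    have h1 : (v : ℤ_[2]) + (((v' : ℤ) - v : ℤ) : ℤ_[2]) = v' := by push_cast; ring
    rw [h1, ramp_natCast hlt', min_eq_left hlt.le, ← AddCircle.coe_sub]
    refine (norm_coe_unitAddCircle_le _).trans ?_
    have hLR : (0 : ℝ) < blockLength m := by exact_mod_cast hL
    have hw : (rampLength m : ℝ) = blockLength m * 2 ^ m := by exact_mod_cast rampLength_eq m
    have hvr : (v' : ℝ) = (v % blockLength m : ℕ) + blockLength m * k := by exact_mod_cast hv'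
    have hr0 : (0 : ℝ) ≤ (v % blockLength m : ℕ) := by positivity
    have hr1 : ((v % blockLength m : ℕ) : ℝ) ≤ blockLength m := by exact_mod_cast hmod.le
    have h2 : (v' : ℝ) / rampLength m - s =
        ((v % blockLength m : ℕ) / blockLength m + (k - s * 2 ^ m)) * (1 / 2) ^ m := by
      rw [hw, hvr, one_div, inv_pow]
      field_simp
      ring
    have h3 : ((v % blockLength m : ℕ) : ℝ) / blockLength m ≤ 1 := (div_le_one hLR).2 hr1
    have h4 : 0 ≤ ((v % blockLength m : ℕ) : ℝ) / blockLength m := by positivity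
    rw [h2, abs_mul, abs_of_pos (show (0 : ℝ) < (1 / 2) ^ m by positivity)]
    refine mul_le_of_le_one_left (by positivity) (abs_le.2 ⟨?_, ?_⟩) <;> linarith

theorem norm_intCast_le_of_blockLength_dvd {m : ℕ} {n : ℤ} (h : (blockLength m : ℤ) ∣ n) :
    ‖(n : ℤ_[2])‖ ≤ (1 / 2) ^ m := by
  have h1 : ‖(n : ℤ_[2])‖ ≤ ((2 : ℕ) : ℝ) ^ (-((m + 1) ^ 2 : ℕ) : ℤ) :=
    norm_int_le_pow_iff_dvd.2 (by exact_mod_cast h)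
  refine h1.trans ?_
  rw [zpow_neg, zpow_natCast, one_div, inv_pow]
  push_cast
  gcongr
  · norm_num
  · nlinarith

/-- The chosen times are divisible by Lₘ, hence tend to 0 in the base, while the cocycle there
differs from t by at most 2 · 2^(-m). -/
theorem mem_closure_orbit_skewFlow_fiber (p : ℤ_[2] × UnitAddCircle) (t : UnitAddCircle) :
    (p.1, p.2 + t) ∈ closure (Set.range fun n : ℤ => (skewFlow ^ n) p) := by
  have hex (m : ℕ) := exists_norm_ramp_sub_le m p.1 (ramp m p.1 + t)
  choose n hd hn ht using hex
  have hz : Tendsto (fun m : ℕ => (1 / 2 : ℝ) ^ m) atTop (𝓝 0) :=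
    tendsto_pow_atTop_nhds_zero_of_lt_one (by norm_num) (by norm_num)
  refine mem_closure_of_tendsto (f := fun m => (skewFlow ^ n m) p) (b := atTop) ?_
    (univ_mem' fun m => ⟨n m, rfl⟩)
  simp only [skewFlow_zpow, skewMap]
  refine Tendsto.prodMk_nhds ?_ ?_
  · have h1 : Tendsto (fun m => ((n m : ℤ) : ℤ_[2])) atTop (𝓝 0) :=
      squeeze_zero_norm (fun m => norm_intCast_le_of_blockLength_dvd (hd m)) hz
    simpa using h1.const_add p.1
  · refine Tendsto.const_add p.2 ?_
    rw [tendsto_iff_norm_sub_tendsto_zero]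
    refine squeeze_zero (fun _ => norm_nonneg _) (fun m => ?_) (by simpa only [mul_zero] using hz.const_mul 2)
    have h1 := norm_cocycle_sub_le (hd m) (hn m) p.1
    have h2 : cocycle (n m) p.1 - t =
        (cocycle (n m) p.1 - (ramp m (p.1 + n m) - ramp m p.1)) +
          (ramp m (p.1 + n m) - (ramp m p.1 + t)) := by abel
    rw [h2, two_mul]
    exact (norm_add_le _ _).trans (add_le_add h1 (ht m))

theorem isMinimalFlow_skewFlow : IsMinimalFlow skewFlow where
  nonempty := inferInstance
  dense_orbit p := by
    rintro ⟨x, y⟩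
    -- The closure contains the whole fiber over `p.1`; translating by the flow yields the fibers
    -- over the base orbit, which is dense.
    have h1 (n : ℤ) : (p.1 + n, y) ∈ closure (Set.range fun n : ℤ => (skewFlow ^ n) p) := by
      have h2 := zpow_mem_closure_orbit
        (mem_closure_orbit_skewFlow_fiber p (y - p.2 - cocycle n p.1)) n
      rw [skewFlow_zpow, skewMap] at h2
      have h3 : p.2 + (y - p.2 - cocycle n p.1) + cocycle n p.1 = y := by abel
      rwa [h3] at h2
    have h3 : Dense (Set.range fun n : ℤ => p.1 + (n : ℤ_[2])) := by
      have := (Homeomorph.addLeft p.1).surjective.denseRange.comp denseRange_intCast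
        (Homeomorph.addLeft p.1).continuous
      exact this
    have hcl : IsClosed {z : ℤ_[2] | (z, y) ∈ closure (Set.range fun n : ℤ => (skewFlow ^ n) p)} :=
      isClosed_closure.preimage (by fun_prop)
    refine hcl.closure_subset_iff.2 ?_ (h3 x)
    rintro _ ⟨n, rfl⟩
    exact h1 n

end Odometer

end WeylDistal

namespace WeylDistal

/-! ### Biased averages of the fiber character -/

section Odometer

open Filter PadicInt

theorem sum_range_mul_of_periodic {P : ℕ} {f : ℕ → ℝ} (hf : ∀ n, f (n + P) = f n) (q : ℕ) :
    ∑ n ∈ Finset.range (P * q), f n = q * ∑ n ∈ Finset.range P, f n := by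
  have hf' (q n : ℕ) : f (P * q + n) = f n := by
    induction q with
    | zero => simp
    | succ q ih => rw [← ih, ← hf (P * q + n)]; congr 1; ring
  induction q with
  | zero => simp
  | succ q ih =>
    rw [mul_add, mul_one, Finset.sum_range_add, ih]
    simp only [hf']
    push_cast
    ring

-- In each period the ramp can be nonzero only during its winding part, of density wᵢ / Lᵢ₊₁ =
-- 2^(-(i+3)).
open Classical in
theorem sum_ramp_ne_zero_le {i m : ℕ} (h : i < m) :
    ∑ n ∈ Finset.range (blockLength m), (if ramp i (n : ℤ_[2]) = 0 then 0 else (1 : ℝ)) ≤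
      blockLength m * (1 / 2) ^ (i + 3) := by
  obtain ⟨q, hq⟩ := blockLength_dvd (Nat.succ_le_of_lt h)
  rw [Nat.succ_eq_add_one] at hq
  rw [hq, sum_range_mul_of_periodic]
  · have h1 : ∑ n ∈ Finset.range (blockLength (i + 1)),
        (if ramp i (n : ℤ_[2]) = 0 then 0 else (1 : ℝ)) ≤ rampLength i := by
      rw [← Finset.sum_subset (Finset.range_subset_range.2 (rampLength_le i))]
      · refine (Finset.sum_le_card_nsmul _ _ 1 fun n _ => ?_).trans (by simp)
        split_ifs <;> norm_num
      · intro n hn hn'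
        rw [Finset.mem_range] at hn hn'
        rw [if_pos (ramp_natCast_of_le hn (not_lt.1 hn'))]
    calc (q : ℝ) * _ ≤ q * rampLength i := by gcongr
      _ = _ := by
        rw [blockLength_succ]
        push_cast
        rw [one_div, inv_pow]
        field_simp
  · intro n
    have := ramp_add_intCast (i := i) (n := (blockLength (i + 1) : ℕ)) dvd_rfl n
    rw [Int.cast_natCast] at this
    rw [Nat.cast_add, this]

/-- The character of the fiber. -/
noncomputable def fiberCharacter : C(ℤ_[2] × UnitAddCircle, ℂ) :=
  ⟨fun p => (AddCircle.toCircle p.2 : ℂ),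
    continuous_subtype_val.comp (AddCircle.continuous_toCircle.comp continuous_snd)⟩

/-- The last Lₘ points of a period of the i-th ramp lie in its flat part, since Lₘ ≤ wᵢ ≤ Lᵢ₊₁ / 2.
The window therefore ends just before 0: just after 0 these ramps would already be climbing. -/
theorem ramp_sub_blockLength {i m n : ℕ} (h : m ≤ i) (hn : n < blockLength m) :
    ramp i (((n : ℤ) - blockLength m : ℤ) : ℤ_[2]) = 0 := by
  have h1 : blockLength m ≤ blockLength i := Nat.le_of_dvd (blockLength_pos i) (blockLength_dvd h)
  have h2 : blockLength i ≤ rampLength i := by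
    rw [rampLength_eq]
    exact Nat.le_mul_of_pos_right _ (by positivity)
  have h3 : rampLength i * 2 ≤ blockLength (i + 1) := by
    rw [blockLength_succ]
    exact Nat.mul_le_mul_left _ (Nat.le_self_pow (by omega) 2)
  rw [← ramp_add_intCast (n := (blockLength (i + 1) : ℕ)) dvd_rfl, ← Int.cast_add]
  have h4 : (n : ℤ) - blockLength m + (blockLength (i + 1) : ℕ) =
      ((n + blockLength (i + 1) - blockLength m : ℕ) : ℤ) := by omega
  rw [h4, Int.cast_natCast]
  exact ramp_natCast_of_le (by omega) (by omega)

/-- On the window [-Lₘ, 0) the ramps with i ≥ m vanish, and the others are all zero except on a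
proportion at most 1/4 of the points. Where all vanish the character is 1, elsewhere its real part
is at least -1, so the average has real part at least 1 - 2/4 = 1/2. -/
theorem windowAverage_fiberCharacter (m : ℕ) :
    1 / 4 < (windowAverage 0 (blockLength m) fun n =>
      fiberCharacter ((skewFlow ^ n) ((skewFlow ^ (-(blockLength m : ℤ))) 0))).re := by
  classical
  have hL : (0 : ℝ) < blockLength m := by exact_mod_cast blockLength_pos m
  have hval (n : ℕ) : fiberCharacter ((skewFlow ^ (0 + (n : ℤ)))
      ((skewFlow ^ (-(blockLength m : ℤ))) 0)) =
      (AddCircle.toCircle (cocycle ((n : ℤ) - blockLength m) 0) : ℂ) := by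
    rw [← Homeomorph.mul_apply, ← zpow_add, skewFlow_zpow, zero_add, ← sub_eq_add_neg]
    simp [fiberCharacter, skewMap]
  -- A union bound: one nonvanishing ramp already pushes the left side down to the trivial bound -1.
  have hterm (n : ℕ) (hn : n < blockLength m) :
      1 - 2 * ∑ i ∈ Finset.range m, (if ramp i (n : ℤ_[2]) = 0 then 0 else (1 : ℝ)) ≤
        (AddCircle.toCircle (cocycle ((n : ℤ) - blockLength m) 0) : ℂ).re := by
    have hnn (i : ℕ) : 0 ≤ (if ramp i (n : ℤ_[2]) = 0 then 0 else (1 : ℝ)) := by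
      split_ifs <;> norm_num
    by_cases hall : ∀ i < m, ramp i (n : ℤ_[2]) = 0
    · have hc : cocycle ((n : ℤ) - blockLength m) 0 = 0 := by
        rw [cocycle]
        refine (tsum_congr fun i => ?_).trans tsum_zero
        rw [zero_add, ramp_zero, sub_zero]
        rcases lt_or_ge i m with h | h
        · rw [← hall i h, sub_eq_add_neg, Int.cast_add, Int.cast_natCast]
          refine ramp_add_intCast ?_ _
          rw [dvd_neg]
          exact_mod_cast blockLength_dvd (Nat.succ_le_of_lt h)
        · exact ramp_sub_blockLength h hn
      rw [hc, AddCircle.toCircle_zero, Circle.coe_one, Complex.one_re]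
      linarith [Finset.sum_nonneg fun i (_ : i ∈ Finset.range m) => hnn i]
    · push Not at hall
      obtain ⟨i, hi, hne⟩ := hall
      have h1 := Finset.single_le_sum (fun j (_ : j ∈ Finset.range m) => hnn j)
        (Finset.mem_range.2 hi)
      rw [if_neg hne] at h1
      have h2 := (abs_le.1 ((Complex.abs_re_le_norm
        (AddCircle.toCircle (cocycle ((n : ℤ) - blockLength m) 0) : ℂ)).trans
        (Circle.norm_coe _).le)).1
      linarith
  have hgeom : ∑ i ∈ Finset.range m, (1 / 2 : ℝ) ^ (i + 3) ≤ 1 / 4 := by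
    simp only [pow_add]
    rw [← Finset.sum_mul]
    have h1 := (hasSum_geometric_of_lt_one (r := (1 / 2 : ℝ)) (by norm_num) (by norm_num))
    have h2 := sum_le_hasSum (Finset.range m) (fun i _ => by positivity) h1
    norm_num at h2 ⊢
    linarith
  have hsum : (blockLength m : ℝ) * (1 / 2) ≤ ∑ n ∈ Finset.range (blockLength m),
      (AddCircle.toCircle (cocycle ((n : ℤ) - blockLength m) 0) : ℂ).re := by
    refine le_trans ?_ (Finset.sum_le_sum fun n hn => hterm n (Finset.mem_range.1 hn))
    rw [Finset.sum_sub_distrib, ← Finset.mul_sum, Finset.sum_comm]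
    have h1 := Finset.sum_le_sum fun i (hi : i ∈ Finset.range m) =>
      sum_ramp_ne_zero_le (Finset.mem_range.1 hi)
    rw [← Finset.mul_sum] at h1
    have h2 := mul_le_mul_of_nonneg_left hgeom hL.le
    simp only [Finset.sum_const, Finset.card_range, nsmul_eq_mul, mul_one]
    linarith
  rw [windowAverage]
  simp only [hval]
  rw [← Complex.ofReal_natCast, ← Complex.ofReal_inv, Complex.re_ofReal_mul, Complex.re_sum]
  calc (1 / 4 : ℝ) < (blockLength m : ℝ)⁻¹ * (blockLength m * (1 / 2)) := by
        rw [inv_mul_cancel_left₀ hL.ne']; norm_num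
    _ ≤ _ := by gcongr

/-- The half turn of the fibers. -/
noncomputable def fiberHalfTurn : (ℤ_[2] × UnitAddCircle) ≃ₜ (ℤ_[2] × UnitAddCircle) :=
  (Homeomorph.refl _).prodCongr (Homeomorph.addRight ((1 / 2 : ℝ) : UnitAddCircle))

theorem fiberHalfTurn_apply (p : ℤ_[2] × UnitAddCircle) :
    fiberHalfTurn p = (p.1, p.2 + ((1 / 2 : ℝ) : UnitAddCircle)) := rfl

theorem fiberCharacter_fiberHalfTurn (p : ℤ_[2] × UnitAddCircle) :
    fiberCharacter (fiberHalfTurn p) = -fiberCharacter p := by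
  rw [fiberHalfTurn_apply]
  change (AddCircle.toCircle (p.2 + _) : ℂ) = -(AddCircle.toCircle p.2 : ℂ)
  rw [AddCircle.toCircle_add, Circle.coe_mul, AddCircle.toCircle_apply_mk, Circle.coe_exp]
  have h : (((2 * Real.pi / 1 * (1 / 2) : ℝ) : ℂ) * Complex.I) = Real.pi * Complex.I := by
    push_cast
    ring
  rw [h, Complex.exp_pi_mul_I, mul_neg_one]

theorem skewFlow_zpow_fiberHalfTurn (n : ℤ) (p : ℤ_[2] × UnitAddCircle) :
    (skewFlow ^ n) (fiberHalfTurn p) = fiberHalfTurn ((skewFlow ^ n) p) := by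
  simp only [skewFlow_zpow, skewMap, fiberHalfTurn_apply]
  rw [add_right_comm]

theorem tendsto_blockLength : Tendsto blockLength atTop atTop := by
  refine tendsto_atTop_mono (fun m => ?_) tendsto_id
  exact (Nat.lt_two_pow_self (n := m)).le.trans (Nat.pow_le_pow_right (by norm_num) (by nlinarith))

end Odometer

end WeylDistal

theorem corollary2p6 :
    (WeylDistal.weylAlgebra : Set (ℤ →ᵇ ℂ)) ⊂ WeylDistal.distalFunctions ∧
    ∃ (X : Type) (_ : MetricSpace X) (_ : CompactSpace X) (_ : MeasurableSpace X)
      (_ : BorelSpace X) (T : X ≃ₜ X),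
      WeylDistal.IsMinimalFlow T ∧ WeylDistal.IsDistalFlow T ∧
      ¬ WeylDistal.IsStrictlyErgodic T ∧
      ∀ x₀ : X, ¬ WeylDistal.flowAlgebra T x₀ ⊆ (WeylDistal.weylAlgebra : Set (ℤ →ᵇ ℂ)) := by
  open WeylDistal in
  have hmin := isMinimalFlow_skewFlow
  have hdist := isDistalFlow_skewFlow
  have havg := windowAverage_fiberCharacter
  have hneg (m : ℕ) : (windowAverage 0 (blockLength m) fun n => fiberCharacter
      ((skewFlow ^ n) (fiberHalfTurn ((skewFlow ^ (-(blockLength m : ℤ))) 0)))).re < -(1 / 4) := by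
    have h := havg m
    simp only [windowAverage, skewFlow_zpow_fiberHalfTurn, fiberCharacter_fiberHalfTurn,
      Finset.sum_neg_distrib, mul_neg, Complex.neg_re] at h ⊢
    linarith
  have hnot := not_flowAlgebra_subset_weylAlgebra hmin fiberCharacter tendsto_blockLength
    (by norm_num) havg hneg
  have hcomm (x : ℤ_[2] × UnitAddCircle) :
      skewFlow (fiberHalfTurn x) = fiberHalfTurn (skewFlow x) := by
    simpa using skewFlow_zpow_fiberHalfTurn 1 x
  let mX : MeasurableSpace (ℤ_[2] × UnitAddCircle) := borel _
  have hX : BorelSpace (ℤ_[2] × UnitAddCircle) := ⟨rfl⟩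
  refine ⟨⟨weylAlgebra_subset_distalFunctions, fun h => hnot 0 fun f hf => h ?_⟩,
    ℤ_[2] × UnitAddCircle, inferInstance, inferInstance, mX, hX, skewFlow, hmin, hdist,
    fun h => ?_, hnot⟩
  · exact ⟨_, inferInstance, inferInstance, inferInstance, skewFlow, 0, hmin, hdist, hf⟩
  · exact not_isUniquelyErgodic_of_windowAverage hcomm tendsto_blockLength _ fiberCharacter
      (by norm_num) havg fiberCharacter_fiberHalfTurn h.1
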